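/- Let $\mathbb K$ be a field of characteristic zero. Let $(\mathcal O,\mu,e)$ be a unital non-$\Sigma$ operad with multiplication in $\mathbb K$-modules: $\mathbb K$-modules $\mathcal O(p)$, $p\ge 0$, with bilinear partial compositions $\varphi\circ_i\psi\in\mathcal O(p+q-1)$, $1\le i\le p$ (and $\varphi\circ_i\psi=0$ for $i>p$), satisfying $(\varphi\circ_i\psi)\circ_j\chi=(\varphi\circ_j\chi)\circ_{i+r-1}\psi$ if $j<i$, $=\varphi\circ_i(\psi\circ_{j-i+1}\chi)$ if $i\le j<q+i$, $=(\varphi\circ_{j-q+1}\chi)\circ_i\psi$ if $j\ge q+i$, for $\varphi\in\mathcal O(p),\psi\in\mathcal O(q),\chi\in\mathcal O(r)$; with an identity $\mathbb 1\in\mathcal O(1)$, $\varphi\circ_i\mathbb 1=\varphi=\mathbb 1\circ_1\varphi$; and with $\mu\in\mathcal O(2)$, $e\in\mathcal O(0)$ such that $\mu\circ_1\mu=\mu\circ_2\mu$ and $\mu\circ_1e=\mu\circ_2e=\mathbb 1$. Let $\mathcal N$ be a cyclic unital opposite $\mathcal O$-module: $\mathbb K$-modules $\mathcal N(n)$, $n\ge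 0$, with linear maps $\bullet_i:\mathcal O(p)\otimes\mathcal N(n)\to\mathcal N(n-p+1)$, $0\le i\le n-p+1$, satisfying $\varphi\bullet_i(\psi\bullet_jx)=\psi\bullet_j(\varphi\bullet_{i+q-1}x)$ if $j<i$, $=(\varphi\circ_{j-i+1}\psi)\bullet_ix$ if $j-p<i\le j$, $=\psi\bullet_{j-p+1}(\varphi\bullet_ix)$ if $0\le i\le j-p$, and $\mathbb 1\bullet_ix=x$ for $0\le i\le n$; and linear maps $t:\mathcal N(n)\to\mathcal N(n)$ with $t(\varphi\bullet_ix)=\varphi\bullet_{i+1}t(x)$ for $0\le i\le n-p$ and $t^{n+1}=\mathrm{id}$ on $\mathcal N(n)$. We put $\mathcal N(m)=0$ for $m<0$ and $\mathcal O(-1)=0$. For $\varphi\in\mathcal O(p)$, $\psi\in\mathcal O(q)$, $x\in\mathcal N(n)$ put \begin{align*} \delta\varphi&=\mu\circ_1\varphi+\sum_{i=1}^p(-1)^i\varphi\circ_{p-i+1}\mu+(-1)^{p+1}\mu\circ_2\varphi,\\ \{\varphi,\psi\}&=\varphi\{\psi\}-(-1)^{(p-1)(q-1)}\psi\{\varphi\},\qquad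 \varphi\{\psi\}=\sum_{i=1}^p(-1)^{(q-1)(i-1)}\varphi\circ_i\psi,\\ b(x)&=\sum_{i=0}^{n-1}(-1)^i\mu\bullet_ix+(-1)^n\mu\bullet_0t(x)\ \ (b=0\text{ on }\mathcal N(0)),\qquad B(x)=\sum_{i=0}^n(-1)^{in}e\bullet_0t^i(x),\\ i_\varphi x&=(\mu\circ_2\varphi)\bullet_0x,\\ L_\varphi x&=\sum_{i=1}^{n-p+1}(-1)^{(p-1)(i-1)}\varphi\bullet_ix+\sum_{i=1}^p(-1)^{n(i-1)+p-1}\varphi\bullet_0t^{i-1}(x)\ \ (L_\varphi x=0\text{ if }p>n+1),\\ S_\varphi x&=\sum_{j=1}^{n-p+1}\sum_{i=j}^{n-p+1}(-1)^{n(j-1)+(p-1)(i-1)}e\bullet_0(\varphi\bullet_it^{j-1}(x))\ \ (S_\varphi x=0\text{ if }p>n),\\ T(\varphi,\psi)(x)&=\sum_{j=1}^{p-1}\sum_{i=j}^{p-1}(-1)^{n(j-1)+(q-1)(i-j)+p+q-1}(\varphi\circ_{p-i+j}\psi)\bullet_0t^{j-1}(x)\in\mathcal N(n-p-q+2). \end{align*}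 Let $\overline{\mathcal N}$ be the quotient of $\mathcal N=\bigoplus_n\mathcal N(n)$ by the span of the images of the degeneracies $s_j(x)=e\bullet_{j+1}x$, $x\in\mathcal N(n)$, $0\le j\le n$, and let $\overline{\mathcal O}(p)=\{\varphi\in\mathcal O(p):\varphi\circ_ie=0\text{ for }1\le i\le p\}$. Brackets $[F,G]=FG-(-1)^{|F||G|}GF$ are graded commutators, where $i_\varphi,L_\varphi,S_\varphi,T(\varphi,\psi),b,B$ have degrees $-p,\,1-p,\,2-p,\,2-p-q,\,-1,\,1$ (only parities matter). Then for all $\varphi\in\mathcal O(p)$, $\psi\in\mathcal O(q)$ one has on $\mathcal N$ $$[i_\psi,L_\varphi]-i_{\{\psi,\varphi\}}=[b,T(\varphi,\psi)]+(-1)^{q-1}T(\delta\varphi,\psi)+T(\varphi,\delta\psi).$$ Moreover $\overline{\mathcal O}$ is closed under $\delta$ and $\{\cdot,\cdot\}$; the operators $b$, $B$ and, for $\varphi\in\overline{\mathcal O}(p)$, $\psi\in\overline{\mathcal O}(q)$, the operators $i_\varphi,L_\varphi,S_\varphi,T(\varphi,\psi)$ descend to $\overline{\mathcal N}$, and for such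 $\varphi,\psi$ one has on $\overline{\mathcal N}$ $$[S_\psi,L_\varphi]-S_{\{\psi,\varphi\}}=[B,T(\varphi,\psi)]$$ and $$[i_\psi+S_\psi,L_\varphi]-i_{\{\psi,\varphi\}}-S_{\{\psi,\varphi\}}=[b+B,T(\varphi,\psi)]+(-1)^{q-1}T(\delta\varphi,\psi)+T(\varphi,\delta\psi).$$ -/

import Mathlib

open scoped DirectSum

noncomputable section

/-- The sign `(-1) ^ k` for an integer exponent `k`. -/
abbrev sgn (k : ℤ) : ℤˣ := k.negOnePow

/-- A unital non-symmetric operad in `K`-modules, given by partial compositions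
`φ ∘_i ψ ∈ O (p + q - 1)` for `φ ∈ O p`, `ψ ∈ O q`.  The arity `r = p + q - 1` of the result is
carried by an equation `r + 1 = p + q`; the composition is `0` unless `1 ≤ i ≤ p`. -/
structure NSOperad (K : Type*) [CommRing K] (O : ℕ → Type*)
    [∀ n, AddCommGroup (O n)] [∀ n, Module K (O n)] where
  /-- partial composition `φ ∘_i ψ` -/
  comp : ∀ {p q r : ℕ}, ℕ → r + 1 = p + q → (O p →ₗ[K] O q →ₗ[K] O r)
  comp_eq_zero : ∀ {p q r : ℕ} (i : ℕ) (h : r + 1 = p + q) (φ : O p) (ψ : O q),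
    i = 0 ∨ p < i → comp i h φ ψ = 0
  /-- `(φ ∘_i ψ) ∘_j χ = (φ ∘_j χ) ∘_{i+r-1} ψ` if `j < i` -/
  assoc_lt : ∀ {p q r a b d : ℕ} (ha : a + 1 = p + q) (hd : d + 1 = a + r)
    (hb : b + 1 = p + r) (hd' : d + 1 = b + q) (φ : O p) (ψ : O q) (χ : O r) (i j : ℕ),
    1 ≤ j → j < i → i ≤ p →
    comp j hd (comp i ha φ ψ) χ = comp (i + r - 1) hd' (comp j hb φ χ) ψ
  /-- `(φ ∘_i ψ) ∘_j χ = φ ∘_i (ψ ∘_{j-i+1} χ)` if `i ≤ j < q + i` -/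
  assoc_mid : ∀ {p q r a c d : ℕ} (ha : a + 1 = p + q) (hd : d + 1 = a + r)
    (hc : c + 1 = q + r) (hd' : d + 1 = p + c) (φ : O p) (ψ : O q) (χ : O r) (i j : ℕ),
    1 ≤ i → i ≤ p → i ≤ j → j < q + i →
    comp j hd (comp i ha φ ψ) χ = comp i hd' φ (comp (j - i + 1) hc ψ χ)
  /-- `(φ ∘_i ψ) ∘_j χ = (φ ∘_{j-q+1} χ) ∘_i ψ` if `j ≥ q + i` -/
  assoc_gt : ∀ {p q r a b d : ℕ} (ha : a + 1 = p + q) (hd : d + 1 = a + r)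
    (hb : b + 1 = p + r) (hd' : d + 1 = b + q) (φ : O p) (ψ : O q) (χ : O r) (i j : ℕ),
    1 ≤ i → i ≤ p → q + i ≤ j → j ≤ a →
    comp j hd (comp i ha φ ψ) χ = comp i hd' (comp (j + 1 - q) hb φ χ) ψ
  /-- the identity operation -/
  one : O 1
  comp_one : ∀ {p : ℕ} (i : ℕ) (φ : O p), 1 ≤ i → i ≤ p →
    comp i (rfl : p + 1 = p + 1) φ one = φ
  one_comp : ∀ {p : ℕ} (φ : O p), comp 1 (Nat.add_comm p 1) one φ = φ

/-- An operad with multiplication `(O, μ, e)`. -/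
structure OperadWithMul (K : Type*) [CommRing K] (O : ℕ → Type*)
    [∀ n, AddCommGroup (O n)] [∀ n, Module K (O n)] extends NSOperad K O where
  /-- the multiplication -/
  mu : O 2
  /-- the unit of the multiplication -/
  e : O 0
  mu_assoc : comp (p := 2) (q := 2) (r := 3) 1 rfl mu mu = comp (p := 2) (q := 2) (r := 3) 2 rfl mu mu
  mu_comp_one_e : comp (p := 2) (q := 0) (r := 1) 1 rfl mu e = one
  mu_comp_two_e : comp (p := 2) (q := 0) (r := 1) 2 rfl mu e = one

namespace OperadWithMul

variable {K : Type*} [CommRing K] {O : ℕ → Type*}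
  [∀ n, AddCommGroup (O n)] [∀ n, Module K (O n)]

/-- The differential `δ φ = μ ∘_1 φ + ∑_{i=1}^p (-1)^i φ ∘_{p-i+1} μ + (-1)^{p+1} μ ∘_2 φ`. -/
def delta (P : OperadWithMul K O) {p : ℕ} (φ : O p) : O (p + 1) :=
  P.comp 1 (by omega : p + 1 + 1 = 2 + p) P.mu φ
    + ∑ i ∈ Finset.Icc 1 p, sgn i • P.comp (p := p) (q := 2) (p - i + 1) rfl φ P.mu
    + sgn (p + 1) • P.comp 2 (by omega : p + 1 + 1 = 2 + p) P.mu φ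

/-- The brace `φ{ψ} = ∑_{i=1}^p (-1)^{(q-1)(i-1)} φ ∘_i ψ`. -/
def brace (P : OperadWithMul K O) {p q r : ℕ} (h : r + 1 = p + q) (φ : O p) (ψ : O q) : O r :=
  ∑ i ∈ Finset.Icc 1 p, sgn (((q : ℤ) - 1) * ((i : ℤ) - 1)) • P.comp i h φ ψ

/-- The Gerstenhaber bracket `{φ, ψ} = φ{ψ} - (-1)^{(p-1)(q-1)} ψ{φ}` in `O (p + q - 1)`.
For `p = q = 0` its arity would be `-1`, and it is `0`. -/
def bracket (P : OperadWithMul K O) {p q : ℕ} (φ : O p) (ψ : O q) : O (p + q - 1) :=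
  if h : 1 ≤ p + q then
    P.brace (by omega : p + q - 1 + 1 = p + q) φ ψ
      - sgn (((p : ℤ) - 1) * ((q : ℤ) - 1)) • P.brace (by omega : p + q - 1 + 1 = q + p) ψ φ
  else 0

/-- `φ ∈ O p` is normalised if it lies in the kernel of all codegeneracies
`σ_j φ = φ ∘_{p-j} e`, `j = 0, …, p - 1`. -/
def IsNormalized (P : OperadWithMul K O) {p : ℕ} (φ : O p) : Prop :=
  ∀ j r : ℕ, j < p → ∀ h : r + 1 = p + 0, P.comp (p - j) h φ P.e = 0

end OperadWithMul

/-- A cyclic unital opposite (left) module over an operad: composition maps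
`φ •_i x ∈ N (n - p + 1)` for `φ ∈ O p`, `x ∈ N n` and `0 ≤ i ≤ n - p + 1`, together with cyclic
operators `t` on all `N n`.  The degree `m = n - p + 1` of the result is carried by an equation
`m + p = n + 1` (so there is no composition if `p > n + 1`), and `φ •_i x` is `0` for `i > m`. -/
structure CyclicOppositeModule {K : Type*} [CommRing K] {O : ℕ → Type*}
    [∀ n, AddCommGroup (O n)] [∀ n, Module K (O n)] (P : NSOperad K O) (N : ℕ → Type*)
    [∀ n, AddCommGroup (N n)] [∀ n, Module K (N n)] where
  /-- the composition maps `φ •_i x` -/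
  bul : ∀ {p n m : ℕ}, ℕ → m + p = n + 1 → (O p →ₗ[K] N n →ₗ[K] N m)
  bul_eq_zero : ∀ {p n m : ℕ} (i : ℕ) (h : m + p = n + 1) (φ : O p) (x : N n),
    m < i → bul i h φ x = 0
  /-- `φ •_i (ψ •_j x) = ψ •_j (φ •_{i+q-1} x)` if `j < i` -/
  bul_bul_lt : ∀ {p q n k l m : ℕ} (hk : k + q = n + 1) (hm : m + p = k + 1)
    (hl : l + p = n + 1) (hm' : m + q = l + 1) (φ : O p) (ψ : O q) (x : N n) (i j : ℕ),
    j < i → i ≤ m →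
    bul i hm φ (bul j hk ψ x) = bul j hm' ψ (bul (i + q - 1) hl φ x)
  /-- `φ •_i (ψ •_j x) = (φ ∘_{j-i+1} ψ) •_i x` if `j - p < i ≤ j` (whence `p > 0`) -/
  bul_bul_mid : ∀ {p q r n k m : ℕ} (hk : k + q = n + 1) (hm : m + p = k + 1)
    (hr : r + 1 = p + q) (hm' : m + r = n + 1) (φ : O p) (ψ : O q) (x : N n) (i j : ℕ),
    j < i + p → i ≤ j → i ≤ m →
    bul i hm φ (bul j hk ψ x) = bul i hm' (P.comp (j - i + 1) hr φ ψ) x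
  /-- `φ •_i (ψ •_j x) = ψ •_{j-p+1} (φ •_i x)` if `0 ≤ i ≤ j - p` (including `p = 0`) -/
  bul_bul_gt : ∀ {p q n k l m : ℕ} (hk : k + q = n + 1) (hm : m + p = k + 1)
    (hl : l + p = n + 1) (hm' : m + q = l + 1) (φ : O p) (ψ : O q) (x : N n) (i j : ℕ),
    i + p ≤ j → j ≤ k →
    bul i hm φ (bul j hk ψ x) = bul (j + 1 - p) hm' ψ (bul i hl φ x)
  one_bul : ∀ {n : ℕ} (i : ℕ) (x : N n), i ≤ n →
    bul i (rfl : n + 1 = n + 1) P.one x = x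
  /-- the cyclic operator -/
  t : ∀ n : ℕ, N n →ₗ[K] N n
  t_bul : ∀ {p n m : ℕ} (h : m + p = n + 1) (φ : O p) (x : N n) (i : ℕ), i + 1 ≤ m →
    t m (bul i h φ x) = bul (i + 1) h φ (t n x)
  t_pow : ∀ (n : ℕ) (x : N n), (t n ^ (n + 1)) x = x

/-- The graded commutator `[F, G] = F G - (-1)^{a c} G F` of operators `F`, `G` of degrees
(or just parities) `a`, `c`. -/
def gradedComm {K V : Type*} [CommRing K] [AddCommGroup V] [Module K V] (a c : ℤ)
    (F G : Module.End K V) : Module.End K V :=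
  F * G - sgn (a * c) • (G * F)

namespace CyclicOppositeModule

variable {K : Type*} [CommRing K] {O : ℕ → Type*}
  [∀ n, AddCommGroup (O n)] [∀ n, Module K (O n)] {P : OperadWithMul K O} {N : ℕ → Type*}
  [∀ n, AddCommGroup (N n)] [∀ n, Module K (N n)]

/-! All operators are endomorphisms of the total space `⨁ n, N n`, given by their values on the
components `N n`; a component whose target would have negative degree is zero. -/

/-- The faces `d_i x = μ •_i x` for `i ≤ n` and `d_{n+1} x = μ •_0 t x` on `N (n + 1)`. -/
def face (M : CyclicOppositeModule P.toNSOperad N) (n i : ℕ) : N (n + 1) →ₗ[K] N n :=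
  if i ≤ n then M.bul i (rfl : n + 2 = n + 1 + 1) P.mu
  else M.bul 0 (rfl : n + 2 = n + 1 + 1) P.mu ∘ₗ M.t (n + 1)

/-- The degeneracies `s_j x = e •_{j+1} x` on `N n`, `j = 0, …, n`. -/
def degen (M : CyclicOppositeModule P.toNSOperad N) (n j : ℕ) : N n →ₗ[K] N (n + 1) :=
  M.bul (j + 1) (rfl : n + 1 + 0 = n + 1) P.e

/-- The differential `b = ∑_{i=0}^n (-1)^i d_i` on `N n`, zero on `N 0`. -/
def b (M : CyclicOppositeModule P.toNSOperad N) : Module.End K (⨁ n, N n) :=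
  DirectSum.toModule K ℕ (⨁ n, N n) fun n =>
    match n with
    | 0 => 0
    | n + 1 => DirectSum.lof K ℕ N n ∘ₗ ∑ i ∈ Finset.range (n + 2), sgn i • M.face n i

/-- The operator `B x = ∑_{i=0}^n (-1)^{i n} e •_0 t^i x` on `N n`. -/
def B (M : CyclicOppositeModule P.toNSOperad N) : Module.End K (⨁ n, N n) :=
  DirectSum.toModule K ℕ (⨁ n, N n) fun n =>
    DirectSum.lof K ℕ N (n + 1) ∘ₗ ∑ i ∈ Finset.range (n + 1),
      sgn ((i : ℤ) * n) • (M.bul 0 (rfl : n + 1 + 0 = n + 1) P.e ∘ₗ M.t n ^ i)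

/-- The contraction `i_φ x = (μ ∘_2 φ) •_0 x`. -/
def contraction (M : CyclicOppositeModule P.toNSOperad N) {p : ℕ} (φ : O p) :
    Module.End K (⨁ n, N n) :=
  DirectSum.toModule K ℕ (⨁ n, N n) fun n =>
    if h : p ≤ n then
      DirectSum.lof K ℕ N (n - p) ∘ₗ
        M.bul 0 (by omega : n - p + (p + 1) = n + 1)
          (P.comp 2 (by omega : p + 1 + 1 = 2 + p) P.mu φ)
    else 0

/-- The Lie derivative
`L_φ x = ∑_{i=1}^{n-p+1} (-1)^{(p-1)(i-1)} φ •_i x + ∑_{i=1}^p (-1)^{n(i-1)+p-1} φ •_0 t^{i-1} x`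
for `x ∈ N n` and `p ≤ n + 1`, and `L_φ x = 0` for `p > n + 1`. -/
def lieDeriv (M : CyclicOppositeModule P.toNSOperad N) {p : ℕ} (φ : O p) :
    Module.End K (⨁ n, N n) :=
  DirectSum.toModule K ℕ (⨁ n, N n) fun n =>
    if h : p ≤ n + 1 then
      DirectSum.lof K ℕ N (n + 1 - p) ∘ₗ
        (∑ i ∈ Finset.Icc 1 (n + 1 - p), sgn (((p : ℤ) - 1) * ((i : ℤ) - 1)) •
            M.bul i (by omega : n + 1 - p + p = n + 1) φ
          + ∑ i ∈ Finset.Icc 1 p, sgn ((n : ℤ) * ((i : ℤ) - 1) + p - 1) •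
            (M.bul 0 (by omega : n + 1 - p + p = n + 1) φ ∘ₗ M.t n ^ (i - 1)))
    else 0

/-- The operator
`S_φ x = ∑_{j=1}^{n-p+1} ∑_{i=j}^{n-p+1} (-1)^{n(j-1)+(p-1)(i-1)} e •_0 (φ •_i t^{j-1} x)`
for `x ∈ N n` and `p ≤ n`, and `S_φ x = 0` for `p > n`. -/
def cyclicHomotopy (M : CyclicOppositeModule P.toNSOperad N) {p : ℕ} (φ : O p) :
    Module.End K (⨁ n, N n) :=
  DirectSum.toModule K ℕ (⨁ n, N n) fun n =>
    if h : p ≤ n then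
      DirectSum.lof K ℕ N (n - p + 2) ∘ₗ
        ∑ j ∈ Finset.Icc 1 (n - p + 1), ∑ i ∈ Finset.Icc j (n - p + 1),
          sgn ((n : ℤ) * ((j : ℤ) - 1) + ((p : ℤ) - 1) * ((i : ℤ) - 1)) •
            (M.bul 0 (rfl : n - p + 2 + 0 = n - p + 1 + 1) P.e ∘ₗ
              M.bul i (by omega : n - p + 1 + p = n + 1) φ ∘ₗ M.t n ^ (j - 1))
    else 0

/-- The Gelfand–Daletskii–Tsygan homotopy
`T(φ, ψ) x = ∑_{j=1}^{p-1} ∑_{i=j}^{p-1}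
  (-1)^{n(j-1)+(q-1)(i-j)+p+q-1} (φ ∘_{p-i+j} ψ) •_0 t^{j-1} x`
for `x ∈ N n`, with values in `N (n - p - q + 2)` (zero if that degree is negative; the sum is
empty if `p ≤ 1`). -/
def gdtHomotopy (M : CyclicOppositeModule P.toNSOperad N) {p q : ℕ} (φ : O p) (ψ : O q) :
    Module.End K (⨁ n, N n) :=
  DirectSum.toModule K ℕ (⨁ n, N n) fun n =>
    if h : 1 ≤ p + q ∧ p + q ≤ n + 2 then
      DirectSum.lof K ℕ N (n + 2 - (p + q)) ∘ₗ
        ∑ j ∈ Finset.Icc 1 (p - 1), ∑ i ∈ Finset.Icc j (p - 1),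
          sgn ((n : ℤ) * ((j : ℤ) - 1) + ((q : ℤ) - 1) * ((i : ℤ) - j) + p + q - 1) •
            (M.bul 0 (by omega : n + 2 - (p + q) + (p + q - 1) = n + 1)
              (P.comp (p - i + j) (by omega : p + q - 1 + 1 = p + q) φ ψ) ∘ₗ M.t n ^ (j - 1))
    else 0

/-- The subspace of `⨁ n, N n` spanned by the images of all degeneracies. -/
def degenerate (M : CyclicOppositeModule P.toNSOperad N) : Submodule K (⨁ n, N n) :=
  Submodule.span K {z | ∃ (n j : ℕ) (x : N n), j ≤ n ∧
    z = DirectSum.lof K ℕ N (n + 1) (M.degen n j x)}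

/-- The (total space of the) normalised complex. -/
abbrev Normalized (M : CyclicOppositeModule P.toNSOperad N) : Type _ :=
  (⨁ n, N n) ⧸ M.degenerate

/-- The operator `F` maps degenerate elements to degenerate ones, so that it induces an operator
on the normalised complex. -/
def Descends (M : CyclicOppositeModule P.toNSOperad N) (F : Module.End K (⨁ n, N n)) : Prop :=
  M.degenerate ≤ M.degenerate.comap F

open Classical in
/-- The operator on the normalised complex induced by an operator that descends
(and `0` for one that does not). -/
def induced (M : CyclicOppositeModule P.toNSOperad N) (F : Module.End K (⨁ n, N n)) :
    Module.End K M.Normalized :=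
  if h : M.Descends F then M.degenerate.mapQ M.degenerate F h else 0

end CyclicOppositeModule

end

noncomputable section

/-! Twist every operation by its Koszul sign (`scomp`, `sbul`, `st`). Nested composition and
rotation then obey sign-free rules, disjoint operations of arities p and q exchange with the sign
(-1)^((p-1)(q-1)), and t^(n+1) = id survives because n(n+1) is even. The core of the proof becomes a
set of bijections between index sets.

Up to sign, b is L_μ (on N(n+1)), i_ψ is T(μ,ψ), and δφ is the bracket of μ and φ. Write L = E + F,
where F collects the terms absorbing the marked slot 0. Two expansions hold for arbitrary
operations, up to overall signs: T(φ{χ},ψ) = Out + T(φ,χ{ψ}) + F_φ T(χ,ψ) (`gdt_sbrace_left`,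
`gdtIn_eq`) and T(φ,ψ) L_χ = ± E_χ T(φ,ψ) + T(φ,ψ{χ}) ± Out (`gdt_lie`), with the same Out: the
terms where ψ is not inserted into χ. Apply both with χ = μ, and again with (μ,φ) in place of (φ,χ).
Eliminating the two Outs gives the first identity: the E and F halves recombine into L_φ i_ψ and b
T(φ,ψ).

Similarly S_ψ is ± e •_0 C_ψ, with C_ψ given by `cyc`. If φ is normalised, the unit is killed in
every slot of φ, so L_φ(e •_0 y) = ± e •_0 Σ_i φ •_i y (`lie_sbul_e`) and T(φ,ψ) B = 0
(`gdtHomotopy_B`). Moreover Σ_i φ •_i C_ψ = Out + C_{φ{ψ}} + (norm) T(φ,ψ), while C_ψ L_φ = C_{ψ{φ}}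
± Out (`cycIn_eq`, `cyc_lie`), and e •_0 after the norm is B. This second identity already holds on
N when φ is normalised; passing to the quotient only needs the descent lemmas. The third is the sum
of the first two, since only parities enter graded commutators. -/

theorem sgn_congr {a b : ℤ} (k : ℤ) (h : a = b + 2 * k) : sgn a = sgn b := by
  subst h
  simp [sgn, Int.negOnePow_add]

theorem sgn_mul_sgn (a b : ℤ) : sgn a * sgn b = sgn (a + b) :=
  (Int.negOnePow_add a b).symm

theorem sgn_smul_sgn_smul {A : Type*} [AddCommGroup A] (a b : ℤ) (x : A) :
    sgn a • sgn b • x = sgn (a + b) • x := by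
  rw [smul_smul, sgn_mul_sgn]

/-! ### Compositions and rotations with Koszul signs. -/

namespace NSOperad

variable {K : Type*} [CommRing K] {O : ℕ → Type*}
  [∀ n, AddCommGroup (O n)] [∀ n, Module K (O n)] (P : NSOperad K O)

/-- Partial composition with the Koszul sign. -/
def scomp {p q r : ℕ} (i : ℕ) (h : r + 1 = p + q) : O p →ₗ[K] O q →ₗ[K] O r :=
  sgn (((q : ℤ) - 1) * ((i : ℤ) - 1)) • P.comp i h

theorem scomp_apply {p q r : ℕ} (i : ℕ) (h : r + 1 = p + q) (φ : O p) (ψ : O q) :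
    P.scomp i h φ ψ = sgn (((q : ℤ) - 1) * ((i : ℤ) - 1)) • P.comp i h φ ψ := rfl

/-- Parallel insertions exchange with the Koszul sign of elements of degrees q-1 and r-1. Read
backwards, the same equation covers an insertion to the right of the first one. -/
theorem scomp_comm {p q r a b d : ℕ} (ha : a + 1 = p + q) (hd : d + 1 = a + r)
    (hb : b + 1 = p + r) (hd' : d + 1 = b + q) (φ : O p) (ψ : O q) (χ : O r) (i j i' : ℕ)
    (hj : 1 ≤ j) (hji : j < i) (hi : i ≤ p) (hi' : i' + 1 = i + r) :
    P.scomp j hd (P.scomp i ha φ ψ) χ =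
      sgn (((q : ℤ) - 1) * ((r : ℤ) - 1)) • P.scomp i' hd' (P.scomp j hb φ χ) ψ := by
  obtain rfl : i' = i + r - 1 := by omega
  simp only [scomp_apply, LinearMap.map_smul_of_tower, LinearMap.smul_apply,
    P.assoc_lt ha hd hb hd' φ ψ χ i j hj hji hi]
  simp only [sgn_smul_sgn_smul]
  congr 1
  have : ((i + r - 1 : ℕ) : ℤ) = i + r - 1 := by omega
  rw [this]
  exact sgn_congr (-(((q : ℤ) - 1) * ((r : ℤ) - 1))) (by ring)

theorem scomp_assoc {p q r a c d : ℕ} (ha : a + 1 = p + q) (hd : d + 1 = a + r)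
    (hc : c + 1 = q + r) (hd' : d + 1 = p + c) (φ : O p) (ψ : O q) (χ : O r) (i j k : ℕ)
    (hi : 1 ≤ i) (hip : i ≤ p) (hij : i ≤ j) (hj : j < q + i) (hk : k + i = j + 1) :
    P.scomp j hd (P.scomp i ha φ ψ) χ = P.scomp i hd' φ (P.scomp k hc ψ χ) := by
  obtain rfl : k = j - i + 1 := by omega
  simp only [scomp_apply, LinearMap.map_smul_of_tower, LinearMap.smul_apply,
    P.assoc_mid ha hd hc hd' φ ψ χ i j hi hip hij hj]
  simp only [sgn_smul_sgn_smul]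
  congr 1
  have h1 : ((j - i + 1 : ℕ) : ℤ) = j - i + 1 := by omega
  have h2 : (c : ℤ) = q + r - 1 := by omega
  rw [h1, h2]
  exact sgn_congr 0 (by ring)

end NSOperad

namespace CyclicOppositeModule

variable {K : Type*} [CommRing K] {O : ℕ → Type*}
  [∀ n, AddCommGroup (O n)] [∀ n, Module K (O n)] {P : NSOperad K O} {N : ℕ → Type*}
  [∀ n, AddCommGroup (N n)] [∀ n, Module K (N n)] (M : CyclicOppositeModule P N)

/-- The composition maps with the Koszul sign. -/
def sbul {p n m : ℕ} (i : ℕ) (h : m + p = n + 1) : O p →ₗ[K] N n →ₗ[K] N m :=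
  sgn (((p : ℤ) - 1) * i) • M.bul i h

/-- The cyclic operator with the Koszul sign. -/
def st (n : ℕ) : N n →ₗ[K] N n := sgn n • M.t n

theorem sbul_apply {p n m : ℕ} (i : ℕ) (h : m + p = n + 1) (φ : O p) (x : N n) :
    M.sbul i h φ x = sgn (((p : ℤ) - 1) * i) • M.bul i h φ x := rfl

theorem st_apply (n : ℕ) (x : N n) : M.st n x = sgn n • M.t n x := rfl

theorem sbul_eq_zero {p n m : ℕ} (i : ℕ) (h : m + p = n + 1) (φ : O p) (x : N n) (hi : m < i) :
    M.sbul i h φ x = 0 := by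
  rw [sbul_apply, M.bul_eq_zero i h φ x hi, smul_zero]

theorem sbul_comm {p q n k l m : ℕ} (hk : k + q = n + 1) (hm : m + p = k + 1)
    (hl : l + p = n + 1) (hm' : m + q = l + 1) (φ : O p) (ψ : O q) (x : N n) (i j i' : ℕ)
    (hji : j < i) (hi : i ≤ m) (hi' : i' + 1 = i + q) :
    M.sbul i hm φ (M.sbul j hk ψ x) =
      sgn (((p : ℤ) - 1) * ((q : ℤ) - 1)) • M.sbul j hm' ψ (M.sbul i' hl φ x) := by
  obtain rfl : i' = i + q - 1 := by omega
  simp only [sbul_apply, LinearMap.map_smul_of_tower,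
    M.bul_bul_lt hk hm hl hm' φ ψ x i j hji hi]
  simp only [sgn_smul_sgn_smul]
  congr 1
  have : ((i + q - 1 : ℕ) : ℤ) = i + q - 1 := by omega
  rw [this]
  exact sgn_congr (-(((p : ℤ) - 1) * ((q : ℤ) - 1))) (by ring)

theorem sbul_assoc {p q r n k m : ℕ} (hk : k + q = n + 1) (hm : m + p = k + 1)
    (hr : r + 1 = p + q) (hm' : m + r = n + 1) (φ : O p) (ψ : O q) (x : N n) (i j l : ℕ)
    (hj : j < i + p) (hij : i ≤ j) (hi : i ≤ m) (hl : l + i = j + 1) :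
    M.sbul i hm φ (M.sbul j hk ψ x) = M.sbul i hm' (P.scomp l hr φ ψ) x := by
  obtain rfl : l = j - i + 1 := by omega
  simp only [sbul_apply, P.scomp_apply, LinearMap.map_smul_of_tower,
    LinearMap.smul_apply, M.bul_bul_mid hk hm hr hm' φ ψ x i j hj hij hi]
  simp only [sgn_smul_sgn_smul]
  congr 1
  have h1 : ((j - i + 1 : ℕ) : ℤ) = j - i + 1 := by omega
  have h2 : (r : ℤ) = p + q - 1 := by omega
  rw [h1, h2]
  exact sgn_congr 0 (by ring)

theorem st_sbul {p n m : ℕ} (h : m + p = n + 1) (φ : O p) (x : N n) (i : ℕ) (hi : i + 1 ≤ m) :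
    M.st m (M.sbul i h φ x) = M.sbul (i + 1) h φ (M.st n x) := by
  simp only [sbul_apply, st_apply, LinearMap.map_smul_of_tower, M.t_bul h φ x i hi]
  simp only [sgn_smul_sgn_smul]
  congr 1
  have h2 : (n : ℤ) = m + p - 1 := by omega
  rw [h2]
  push_cast
  exact sgn_congr (1 - p) (by ring)

theorem st_pow_apply (n k : ℕ) (x : N n) :
    (M.st n ^ k) x = sgn ((k : ℤ) * n) • (M.t n ^ k) x := by
  induction k with
  | zero => simp [sgn]
  | succ k ih =>
    rw [pow_succ', pow_succ', Module.End.mul_apply, Module.End.mul_apply, ih, LinearMap.map_smul_of_tower,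
      st_apply, sgn_smul_sgn_smul]
    congr 2
    push_cast
    ring

/-- The total sign of a full turn is (-1)^(n(n+1)) = 1. -/
theorem st_pow_succ_self (n : ℕ) (x : N n) : (M.st n ^ (n + 1)) x = x := by
  rw [st_pow_apply, M.t_pow]
  have h : Even ((((n + 1 : ℕ) : ℤ)) * (n : ℤ)) := by
    push_cast
    rw [mul_comm]
    exact Int.even_mul_succ_self n
  rw [sgn, Int.negOnePow_even _ h, one_smul]

theorem st_pow_st_pow (n a b : ℕ) (x : N n) :
    (M.st n ^ a) ((M.st n ^ b) x) = (M.st n ^ (a + b)) x := by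
  rw [pow_add, Module.End.mul_apply]

theorem st_pow_sbul {p n m : ℕ} (h : m + p = n + 1) (φ : O p) (x : N n) (i a : ℕ)
    (hi : i + a ≤ m) :
    (M.st m ^ a) (M.sbul i h φ x) = M.sbul (i + a) h φ ((M.st n ^ a) x) := by
  induction a with
  | zero => simp
  | succ a ih =>
    rw [pow_succ', pow_succ', Module.End.mul_apply, Module.End.mul_apply, ih (by omega),
      st_sbul _ _ _ _ _ (by omega), add_assoc]

/-- Rotating past the marked slot. -/
theorem st_pow_sbul_wrap {p n m : ℕ} (h : m + p = n + 1) (φ : O p) (x : N n) (i a i' b : ℕ)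
    (hi : i ≤ m) (hi' : i' ≤ m) (hia : i + a = m + 1 + i') (hb : b + 1 = a + p) :
    (M.st m ^ a) (M.sbul i h φ x) = M.sbul i' h φ ((M.st n ^ b) x) := by
  -- An insertion at slot i is t^i of an insertion at slot 0, so a full turn of order m+1 can be
  -- dropped afterwards. The gap p-1 between b and a is the difference of the orders n+1 and m+1.
  have key : M.sbul i h φ x = (M.st m ^ i) (M.sbul 0 h φ ((M.st n ^ (n + 1 - i)) x)) := by
    rw [st_pow_sbul _ _ _ _ _ _ (by omega), st_pow_st_pow, zero_add,
      show i + (n + 1 - i) = n + 1 by omega, st_pow_succ_self]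
  rw [key, st_pow_st_pow, show a + i = i' + (m + 1) by omega, ← st_pow_st_pow, st_pow_succ_self,
    st_pow_sbul _ _ _ _ _ _ (by omega), st_pow_st_pow, zero_add]
  congr 3
  omega

end CyclicOppositeModule

/-! ### Signed braces, L and T in a fixed degree; rotating a Lie derivative. -/

namespace NSOperad

variable {K : Type*} [CommRing K] {O : ℕ → Type*}
  [∀ n, AddCommGroup (O n)] [∀ n, Module K (O n)] (P : NSOperad K O)

/-- The brace `φ{ψ}`. -/
def sbrace {p q r : ℕ} (h : r + 1 = p + q) (φ : O p) (ψ : O q) : O r :=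
  ∑ i ∈ Finset.Icc 1 p, P.scomp i h φ ψ

end NSOperad

namespace CyclicOppositeModule

variable {K : Type*} [CommRing K] {O : ℕ → Type*}
  [∀ n, AddCommGroup (O n)] [∀ n, Module K (O n)] {P : NSOperad K O} {N : ℕ → Type*}
  [∀ n, AddCommGroup (N n)] [∀ n, Module K (N n)] (M : CyclicOppositeModule P N)

/-- The part of the Lie derivative that does not touch the marked slot. -/
def lieE {p n m : ℕ} (h : m + p = n + 1) (φ : O p) : N n →ₗ[K] N m :=
  ∑ i ∈ Finset.Icc 1 m, M.sbul i h φ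

/-- The part of the Lie derivative that absorbs the marked slot. -/
def lieF {p n m : ℕ} (h : m + p = n + 1) (φ : O p) : N n →ₗ[K] N m :=
  ∑ l ∈ Finset.range p, M.sbul 0 h φ ∘ₗ M.st n ^ l

/-- The Lie derivative up to sign, in a fixed degree. -/
def lie {p n m : ℕ} (h : m + p = n + 1) (φ : O p) : N n →ₗ[K] N m :=
  M.lieE h φ + M.lieF h φ

/-- The homotopy `T(φ, ψ)` up to sign, in a fixed degree. -/
def gdt {p q c n m : ℕ} (hc : c + 1 = p + q) (h : m + c = n + 1) (φ : O p) (ψ : O q) :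
    N n →ₗ[K] N m :=
  ∑ j ∈ Finset.range p, ∑ k ∈ Finset.Icc (j + 2) p,
    M.sbul 0 h (P.scomp k hc φ ψ) ∘ₗ M.st n ^ j

theorem lieE_apply {p n m : ℕ} (h : m + p = n + 1) (φ : O p) (x : N n) :
    M.lieE h φ x = ∑ i ∈ Finset.Icc 1 m, M.sbul i h φ x := by
  simp [lieE, LinearMap.sum_apply]

theorem lieF_apply {p n m : ℕ} (h : m + p = n + 1) (φ : O p) (x : N n) :
    M.lieF h φ x = ∑ l ∈ Finset.range p, M.sbul 0 h φ ((M.st n ^ l) x) := by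
  simp [lieF, LinearMap.sum_apply]

theorem gdt_apply {p q c n m : ℕ} (hc : c + 1 = p + q) (h : m + c = n + 1) (φ : O p) (ψ : O q)
    (x : N n) : M.gdt hc h φ ψ x = ∑ j ∈ Finset.range p, ∑ k ∈ Finset.Icc (j + 2) p,
      M.sbul 0 h (P.scomp k hc φ ψ) ((M.st n ^ j) x) := by
  simp [gdt, LinearMap.sum_apply]

/-- Under t^a the F-terms move to slot a, the E-terms that stay in range move to slots beyond a, and
those that wrap around reach the slots below a, with r-1 additional turns of x. -/
theorem st_pow_lie {r n k : ℕ} (h : k + r = n + 1) (χ : O r) (x : N n) (a : ℕ) (ha : a ≤ k) :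
    (M.st k ^ a) (M.lie h χ x) =
      ∑ c ∈ Finset.range a, M.sbul c h χ ((M.st n ^ (a + r - 1)) x)
      + ∑ J ∈ Finset.Ico a (a + r), M.sbul a h χ ((M.st n ^ J) x)
      + ∑ c ∈ Finset.Icc (a + 1) k, M.sbul c h χ ((M.st n ^ a) x) := by
  rw [lie, LinearMap.add_apply, lieE_apply, lieF_apply, map_add, map_sum, map_sum,
    ← Finset.sum_filter_add_sum_filter_not _ (fun i => i + a ≤ k)]
  have h1 : ∑ i ∈ (Finset.Icc 1 k).filter (fun i => i + a ≤ k), (M.st k ^ a) (M.sbul i h χ x)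
      = ∑ c ∈ Finset.Icc (a + 1) k, M.sbul c h χ ((M.st n ^ a) x) := by
    refine Finset.sum_nbij' (fun i => i + a) (fun c => c - a) ?_ ?_ ?_ ?_ ?_ <;>
      simp only [Finset.mem_filter, Finset.mem_Icc] <;> intro i hi
    · omega
    · omega
    · omega
    · omega
    · rw [M.st_pow_sbul _ _ _ _ _ hi.2]
  have h2 : ∑ i ∈ (Finset.Icc 1 k).filter (fun i => ¬ i + a ≤ k), (M.st k ^ a) (M.sbul i h χ x)
      = ∑ c ∈ Finset.range a, M.sbul c h χ ((M.st n ^ (a + r - 1)) x) := by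
    refine Finset.sum_nbij' (fun i => i + a - (k + 1)) (fun c => c + (k + 1) - a) ?_ ?_ ?_ ?_ ?_ <;>
      simp only [Finset.mem_filter, Finset.mem_Icc, Finset.mem_range] <;> intro i hi
    · omega
    · omega
    · omega
    · omega
    · rw [M.st_pow_sbul_wrap h χ x i a (i + a - (k + 1)) (a + r - 1)] <;> omega
  have h3 : ∑ l ∈ Finset.range r, (M.st k ^ a) (M.sbul 0 h χ ((M.st n ^ l) x))
      = ∑ J ∈ Finset.Ico a (a + r), M.sbul a h χ ((M.st n ^ J) x) := by
    rw [Finset.sum_Ico_eq_sum_range]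
    simp only [add_tsub_cancel_left]
    refine Finset.sum_congr rfl fun l _ => ?_
    rw [M.st_pow_sbul _ _ _ _ _ (by omega), st_pow_st_pow, zero_add]
  rw [h1, h2, h3]
  abel

/-- A slot c < s lies under θ, so χ is absorbed as θ ∘_{c+1} χ; slots c ≥ s stay disjoint from θ. -/
theorem sbul_zero_st_pow_lie {s r u n k m : ℕ} (h : k + r = n + 1) (hm : m + s = k + 1)
    (hu : u + 1 = s + r) (hmu : m + u = n + 1)
    (θ : O s) (χ : O r) (x : N n) (a : ℕ) (ha : a < s) :
    M.sbul 0 hm θ ((M.st k ^ a) (M.lie h χ x)) =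
      ∑ i ∈ Finset.Icc 1 a, M.sbul 0 hmu (P.scomp i hu θ χ) ((M.st n ^ (a + r - 1)) x)
      + ∑ J ∈ Finset.Ico a (a + r), M.sbul 0 hmu (P.scomp (a + 1) hu θ χ) ((M.st n ^ J) x)
      + ∑ i ∈ Finset.Icc (a + 2) s, M.sbul 0 hmu (P.scomp i hu θ χ) ((M.st n ^ a) x)
      + ∑ c ∈ Finset.Icc s k, M.sbul 0 hm θ (M.sbul c h χ ((M.st n ^ a) x)) := by
  rw [M.st_pow_lie h χ x a (by omega), map_add, map_add, map_sum, map_sum, map_sum,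
    ← Finset.sum_filter_add_sum_filter_not (Finset.Icc (a + 1) k) (fun c => c < s), ← add_assoc]
  congr 1
  · congr 1
    · congr 1
      · refine Finset.sum_nbij' (fun i => i + 1) (fun c => c - 1) ?_ ?_ ?_ ?_ ?_ <;>
          simp only [Finset.mem_range, Finset.mem_Icc] <;> intro i hi
        · omega
        · omega
        · omega
        · omega
        · exact M.sbul_assoc h hm hu hmu θ χ _ 0 i (i + 1) (by omega) (by omega) (by omega) rfl
      · refine Finset.sum_congr rfl fun J _ => ?_
        exact M.sbul_assoc h hm hu hmu θ χ _ 0 a (a + 1) (by omega) (by omega) (by omega) rfl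
    · refine Finset.sum_nbij' (fun i => i + 1) (fun c => c - 1) ?_ ?_ ?_ ?_ ?_ <;>
          simp only [Finset.mem_filter, Finset.mem_Icc] <;> intro i hi
      · omega
      · omega
      · omega
      · omega
      · exact M.sbul_assoc h hm hu hmu θ χ _ 0 i (i + 1) (by omega) (by omega) (by omega) rfl
  · refine Finset.sum_congr ?_ fun _ _ => rfl
    ext c
    simp only [Finset.mem_filter, Finset.mem_Icc]
    omega

/-- Pulling θ inside shifts slot c to c+1-s, which runs over exactly the slots of E_χ. -/
theorem sum_sbul_zero_sbul {s r n k l m : ℕ} (h : k + r = n + 1) (hm : m + s = k + 1)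
    (hl : l + s = n + 1) (hml : m + r = l + 1) (θ : O s) (χ : O r) (x : N n) :
    ∑ c ∈ Finset.Icc s k, M.sbul 0 hm θ (M.sbul c h χ x) =
      sgn (((s : ℤ) - 1) * ((r : ℤ) - 1)) • M.lieE hml χ (M.sbul 0 hl θ x) := by
  rw [lieE_apply, Finset.smul_sum]
  refine Finset.sum_nbij' (fun i => i + 1 - s) (fun c => c + s - 1) ?_ ?_ ?_ ?_ ?_ <;>
      simp only [Finset.mem_Icc] <;> intro i hi
  · omega
  · omega
  · omega
  · omega
  · rw [M.sbul_comm hl hml h hm χ θ _ (i + 1 - s) 0 i (by omega) (by omega) (by omega),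
      sgn_smul_sgn_smul, sgn_congr (b := 0) (((s : ℤ) - 1) * ((r : ℤ) - 1)) (by ring)]
    simp

end CyclicOppositeModule

/-! ### The two expansions behind the contraction identity: T(φ{χ}, ψ) and T(φ, ψ) L_χ. -/

namespace CyclicOppositeModule

variable {K : Type*} [CommRing K] {O : ℕ → Type*}
  [∀ n, AddCommGroup (O n)] [∀ n, Module K (O n)] {P : NSOperad K O} {N : ℕ → Type*}
  [∀ n, AddCommGroup (N n)] [∀ n, Module K (N n)] (M : CyclicOppositeModule P N)

/-- The index set of the terms of `T(φ{χ}, ψ)`: the triple `(i, J, k)` stands for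
`((φ ∘_i χ) ∘_k ψ) •_0 t^J`. -/
def gdtIndex (p a : ℕ) : Finset (ℕ × ℕ × ℕ) :=
  (Finset.Icc 1 p ×ˢ Finset.range a ×ˢ Finset.Icc 1 a).filter fun z => z.2.1 + 2 ≤ z.2.2

theorem mem_gdtIndex {p a : ℕ} {z : ℕ × ℕ × ℕ} : z ∈ gdtIndex p a ↔
    1 ≤ z.1 ∧ z.1 ≤ p ∧ z.2.1 + 2 ≤ z.2.2 ∧ z.2.2 ≤ a := by
  simp only [gdtIndex, Finset.mem_filter, Finset.mem_product, Finset.mem_Icc, Finset.mem_range]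
  omega

/-- The terms of `T(φ{χ}, ψ)` in which `ψ` is not inserted into `χ`. -/
def gdtOut {p q r a u n m : ℕ} (ha : a + 1 = p + r) (hu : u + 1 = a + q) (hmu : m + u = n + 1)
    (φ : O p) (ψ : O q) (χ : O r) (x : N n) : N m :=
  ∑ z ∈ (gdtIndex p a).filter (fun z => z.2.2 < z.1 ∨ z.1 + r ≤ z.2.2),
    M.sbul 0 hmu (P.scomp z.2.2 hu (P.scomp z.1 ha φ χ) ψ) ((M.st n ^ z.2.1) x)

/-- The terms of `T(φ{χ}, ψ)` in which `ψ` is inserted into `χ`. -/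
def gdtIn {p q r a u n m : ℕ} (ha : a + 1 = p + r) (hu : u + 1 = a + q) (hmu : m + u = n + 1)
    (φ : O p) (ψ : O q) (χ : O r) (x : N n) : N m :=
  ∑ z ∈ (gdtIndex p a).filter (fun z => ¬ (z.2.2 < z.1 ∨ z.1 + r ≤ z.2.2)),
    M.sbul 0 hmu (P.scomp z.2.2 hu (P.scomp z.1 ha φ χ) ψ) ((M.st n ^ z.2.1) x)

theorem gdt_sbrace_left {p q r a u n m : ℕ} (ha : a + 1 = p + r) (hu : u + 1 = a + q)
    (hmu : m + u = n + 1) (φ : O p) (ψ : O q) (χ : O r) (x : N n) :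
    M.gdt hu hmu (P.sbrace ha φ χ) ψ x = M.gdtOut ha hu hmu φ ψ χ x + M.gdtIn ha hu hmu φ ψ χ x := by
  rw [gdtOut, gdtIn, Finset.sum_filter_add_sum_filter_not, gdt_apply]
  simp only [NSOperad.sbrace, map_sum, LinearMap.sum_apply]
  simp only [Finset.sum_sigma']
  refine Finset.sum_nbij' (fun z => (z.2.2, z.1, z.2.1)) (fun z => ⟨z.2.1, z.2.2, z.1⟩)
    ?_ ?_ ?_ ?_ ?_
  · rintro ⟨i, j, k⟩
    simp only [Finset.mem_sigma, mem_gdtIndex, Finset.mem_Icc, Finset.mem_range]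
    omega
  · rintro ⟨i, j, k⟩
    simp only [Finset.mem_sigma, mem_gdtIndex, Finset.mem_Icc, Finset.mem_range]
    omega
  · exact fun _ _ => rfl
  · exact fun _ _ => rfl
  · exact fun _ _ => rfl

/-- Here ψ sits inside χ, and the rotation power J decides. If J+1 < i, the composite χ ∘ ψ plays
the role of the second argument of T(φ, -). If J ≥ i-1, then t^(i-1) can be pulled out in front of χ
∘ ψ, leaving t^(J+1-i) on x: a term of F_φ T(χ,ψ). -/
theorem gdtIn_eq {p q r a u v n m w : ℕ} (ha : a + 1 = p + r) (hu : u + 1 = a + q)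
    (hmu : m + u = n + 1) (hv : v + 1 = r + q) (hu' : u + 1 = p + v)
    (hw : w + v = n + 1) (hm : m + p = w + 1) (φ : O p) (ψ : O q) (χ : O r) (x : N n) :
    M.gdtIn ha hu hmu φ ψ χ x =
      M.gdt hu' hmu φ (P.sbrace hv χ ψ) x + M.lieF hm φ (M.gdt hv hw χ ψ x) := by
  rw [gdtIn, ← Finset.sum_filter_add_sum_filter_not _ (fun z => z.2.1 + 1 < z.1)]
  congr 1
  · rw [gdt_apply]
    simp only [NSOperad.sbrace, map_sum, LinearMap.sum_apply]
    simp only [Finset.sum_sigma']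
    refine Finset.sum_nbij' (fun z => ⟨z.2.1, z.1, z.2.2 + 1 - z.1⟩)
      (fun z => (z.2.1, z.1, z.2.2 + z.2.1 - 1)) ?_ ?_ ?_ ?_ ?_ <;> rintro ⟨i, J, k⟩ <;>
      simp only [Finset.mem_sigma, Finset.mem_filter, mem_gdtIndex, Finset.mem_Icc,
        Finset.mem_range, Prod.mk.injEq, Sigma.mk.injEq, heq_eq_eq, true_and] <;> intro hi
    · omega
    · omega
    · omega
    · omega
    · rw [P.scomp_assoc ha hu hv hu' φ χ ψ i k (k + 1 - i)] <;> omega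
  · rw [gdt_apply, lieF_apply]
    simp only [map_sum]
    simp only [Finset.sum_sigma']
    refine Finset.sum_nbij' (fun z => ⟨z.1 - 1, z.2.1 + 1 - z.1, z.2.2 + 1 - z.1⟩)
      (fun z => (z.1 + 1, z.1 + z.2.1, z.2.2 + z.1)) ?_ ?_ ?_ ?_ ?_ <;> rintro ⟨i, J, k⟩ <;>
      simp only [Finset.mem_sigma, Finset.mem_filter, mem_gdtIndex, Finset.mem_Icc,
        Finset.mem_range, Prod.mk.injEq, Sigma.mk.injEq, heq_eq_eq] <;> intro hi
    · omega
    · omega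
    · omega
    · omega
    · rw [P.scomp_assoc ha hu hv hu' φ χ ψ i k (k + 1 - i) (by omega) (by omega) (by omega)
          (by omega) (by omega), M.st_pow_sbul _ _ _ _ _ (by omega), st_pow_st_pow,
        M.sbul_assoc hw hm hu' hmu φ _ _ 0 (0 + (i - 1)) i (by omega) (by omega) (by omega)
          (by omega), show i - 1 + (J + 1 - i) = J by omega]

/-- The terms of `T(φ, ψ) L_χ` in which `χ` is disjoint from `φ`. -/
def gdtDisj {p q r c n k m : ℕ} (hr : k + r = n + 1) (hc : c + 1 = p + q) (hm : m + c = k + 1)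
    (φ : O p) (ψ : O q) (χ : O r) (x : N n) : N m :=
  ∑ j ∈ Finset.range p, ∑ l ∈ Finset.Icc (j + 2) p, ∑ i ∈ Finset.Icc c k,
    M.sbul 0 hm (P.scomp l hc φ ψ) (M.sbul i hr χ ((M.st n ^ j) x))

theorem gdtDisj_eq {p q r c n k l m : ℕ} (hr : k + r = n + 1) (hc : c + 1 = p + q)
    (hm : m + c = k + 1) (hl : l + c = n + 1) (hml : m + r = l + 1)
    (φ : O p) (ψ : O q) (χ : O r) (x : N n) :
    M.gdtDisj hr hc hm φ ψ χ x =
      sgn (((c : ℤ) - 1) * ((r : ℤ) - 1)) • M.lieE hml χ (M.gdt hc hl φ ψ x) := by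
  simp only [gdtDisj, gdt_apply, map_sum, Finset.smul_sum,
    M.sum_sbul_zero_sbul hr hm hl hml]

/-- In target degree 0 there is no room beside φ ∘ ψ. This covers arity r = 0, where the degree l
required by `gdtDisj_eq` would be -1. -/
theorem gdtDisj_eq_zero {p q r c n k : ℕ} (hr : k + r = n + 1) (hc : c + 1 = p + q)
    (hm : 0 + c = k + 1) (φ : O p) (ψ : O q) (χ : O r) (x : N n) :
    M.gdtDisj hr hc hm φ ψ χ x = 0 := by
  simp [gdtDisj, Finset.Icc_eq_empty (show ¬ c ≤ k by omega)]

/-- The terms of `T(φ, ψ) L_χ` in which `χ` is inserted into `ψ`. -/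
def gdtMid {p q r c u n m : ℕ} (hc : c + 1 = p + q) (hu : u + 1 = c + r) (hmu : m + u = n + 1)
    (φ : O p) (ψ : O q) (χ : O r) (x : N n) : N m :=
  ∑ j ∈ Finset.range p, ∑ l ∈ Finset.Icc (j + 2) p, ∑ i ∈ Finset.Ico l (l + q),
    M.sbul 0 hmu (P.scomp i hu (P.scomp l hc φ ψ) χ) ((M.st n ^ j) x)

theorem gdtMid_eq {p q r c u v n m : ℕ} (hc : c + 1 = p + q) (hu : u + 1 = c + r)
    (hmu : m + u = n + 1) (hv : v + 1 = q + r) (hu' : u + 1 = p + v)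
    (φ : O p) (ψ : O q) (χ : O r) (x : N n) :
    M.gdtMid hc hu hmu φ ψ χ x = M.gdt hu' hmu φ (P.sbrace hv ψ χ) x := by
  rw [gdtMid, gdt_apply]
  simp only [NSOperad.sbrace, map_sum, LinearMap.sum_apply]
  refine Finset.sum_congr rfl fun j hj => Finset.sum_congr rfl fun l hl => ?_
  simp only [Finset.mem_Icc] at hl
  refine Finset.sum_nbij' (fun i => i + 1 - l) (fun i => i + l - 1) ?_ ?_ ?_ ?_ ?_ <;>
    simp only [Finset.mem_Ico, Finset.mem_Icc] <;> intro i hi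
  · omega
  · omega
  · omega
  · omega
  · rw [P.scomp_assoc hc hu hv hu' φ ψ χ l i (i + 1 - l)] <;> omega

/-- Each term puts χ beside φ ∘_l ψ, into ψ, or into another slot of φ. In the last case χ and ψ are
parallel insertions into φ, and exchanging them produces the Out part of T(φ{χ}, ψ). -/
theorem gdt_lie {p q r a c u n k m : ℕ} (ha : a + 1 = p + r) (hu : u + 1 = a + q)
    (hmu : m + u = n + 1) (hr : k + r = n + 1) (hc : c + 1 = p + q) (hm : m + c = k + 1)
    (hu' : u + 1 = c + r) (φ : O p) (ψ : O q) (χ : O r) (x : N n) :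
    M.gdt hc hm φ ψ (M.lie hr χ x) = M.gdtDisj hr hc hm φ ψ χ x + M.gdtMid hc hu' hmu φ ψ χ x
      + sgn (((q : ℤ) - 1) * ((r : ℤ) - 1)) • M.gdtOut ha hu hmu φ ψ χ x := by
  have h0 : M.gdt hc hm φ ψ (M.lie hr χ x) =
      ∑ j ∈ Finset.range p, ∑ l ∈ Finset.Icc (j + 2) p,
        (∑ i ∈ Finset.Icc 1 j, M.sbul 0 hmu (P.scomp i hu' (P.scomp l hc φ ψ) χ)
            ((M.st n ^ (j + r - 1)) x)
        + ∑ J ∈ Finset.Ico j (j + r), M.sbul 0 hmu (P.scomp (j + 1) hu' (P.scomp l hc φ ψ) χ)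
            ((M.st n ^ J) x)
        + (∑ i ∈ Finset.Ico (j + 2) l, M.sbul 0 hmu (P.scomp i hu' (P.scomp l hc φ ψ) χ)
            ((M.st n ^ j) x)
          + ∑ i ∈ Finset.Ico l (l + q), M.sbul 0 hmu (P.scomp i hu' (P.scomp l hc φ ψ) χ)
            ((M.st n ^ j) x)
          + ∑ i ∈ Finset.Icc (l + q) c, M.sbul 0 hmu (P.scomp i hu' (P.scomp l hc φ ψ) χ)
            ((M.st n ^ j) x))
        + ∑ i ∈ Finset.Icc c k, M.sbul 0 hm (P.scomp l hc φ ψ)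
            (M.sbul i hr χ ((M.st n ^ j) x))) := by
    rw [gdt_apply]
    refine Finset.sum_congr rfl fun j hj => Finset.sum_congr rfl fun l hl => ?_
    simp only [Finset.mem_range, Finset.mem_Icc] at hj hl
    rw [M.sbul_zero_st_pow_lie hr hm hu' hmu _ χ x j (by omega)]
    congr 2
    -- The slots of φ ∘_l ψ to the left of ψ, inside ψ, and to the right of ψ.
    have : Finset.Icc (j + 2) c =
        (Finset.Ico (j + 2) l ∪ Finset.Ico l (l + q)) ∪ Finset.Icc (l + q) c := by
      ext i
      simp only [Finset.mem_union, Finset.mem_Icc, Finset.mem_Ico]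
      omega
    rw [this, Finset.sum_union, Finset.sum_union]
    · rw [Finset.disjoint_left]
      intro i
      simp only [Finset.mem_Ico]
      omega
    · rw [Finset.disjoint_left]
      intro i
      simp only [Finset.mem_union, Finset.mem_Icc, Finset.mem_Ico]
      omega
  have h1 : M.gdtOut ha hu hmu φ ψ χ x = sgn (((q : ℤ) - 1) * ((r : ℤ) - 1)) •
      (∑ j ∈ Finset.range p, ∑ l ∈ Finset.Icc (j + 2) p, ∑ i ∈ Finset.Icc 1 j,
        M.sbul 0 hmu (P.scomp i hu' (P.scomp l hc φ ψ) χ) ((M.st n ^ (j + r - 1)) x)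
      + ∑ j ∈ Finset.range p, ∑ l ∈ Finset.Icc (j + 2) p, ∑ J ∈ Finset.Ico j (j + r),
        M.sbul 0 hmu (P.scomp (j + 1) hu' (P.scomp l hc φ ψ) χ) ((M.st n ^ J) x)
      + ∑ j ∈ Finset.range p, ∑ l ∈ Finset.Icc (j + 2) p, ∑ i ∈ Finset.Ico (j + 2) l,
        M.sbul 0 hmu (P.scomp i hu' (P.scomp l hc φ ψ) χ) ((M.st n ^ j) x)
      + ∑ j ∈ Finset.range p, ∑ l ∈ Finset.Icc (j + 2) p, ∑ i ∈ Finset.Icc (l + q) c,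
        M.sbul 0 hmu (P.scomp i hu' (P.scomp l hc φ ψ) χ) ((M.st n ^ j) x)) := by
    -- Four regions match the four sums. If ψ is right of χ, compare the rotation J with the block
    -- of χ, which occupies i-1, …, i+r-2: J beyond it, inside it, or before it. The remaining
    -- region has ψ left of χ.
    rw [gdtOut, ← Finset.sum_filter_add_sum_filter_not _ (fun z => z.2.2 < z.1), add_comm,
      ← Finset.sum_filter_add_sum_filter_not _ (fun z => z.2.1 + 1 < z.1), add_comm (∑ z ∈ _, _),
      ← Finset.sum_filter_add_sum_filter_not _ (fun z => z.1 + r ≤ z.2.1 + 1),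
      smul_add, smul_add, smul_add]
    simp only [Finset.sum_sigma', Finset.smul_sum]
    congr 1
    · congr 1
      · congr 1
        · refine Finset.sum_nbij' (fun z => ⟨z.2.1 + 1 - r, z.2.2 + 1 - r, z.1⟩)
            (fun z => (z.2.2, z.1 + r - 1, z.2.1 + r - 1)) ?_ ?_ ?_ ?_ ?_ <;> rintro ⟨i, J, l⟩ <;>
            simp only [Finset.mem_sigma, Finset.mem_filter, mem_gdtIndex, Finset.mem_Icc,
              Finset.mem_range, Prod.mk.injEq, Sigma.mk.injEq, heq_eq_eq, true_and, and_true] <;> intro hi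
          · omega
          · omega
          · omega
          · omega
          · rw [P.scomp_comm hc hu' ha hu φ ψ χ (l + 1 - r) i l (by omega) (by omega) (by omega)
              (by omega), LinearMap.map_smul_of_tower, LinearMap.smul_apply, sgn_smul_sgn_smul,
              sgn_congr (b := 0) (((q : ℤ) - 1) * ((r : ℤ) - 1)) (by ring),
              show J + 1 - r + r - 1 = J by omega]
            simp
        · refine Finset.sum_nbij' (fun z => ⟨z.1 - 1, z.2.2 + 1 - r, z.2.1⟩)
            (fun z => (z.1 + 1, z.2.2, z.2.1 + r - 1)) ?_ ?_ ?_ ?_ ?_ <;> rintro ⟨i, J, l⟩ <;>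
            simp only [Finset.mem_sigma, Finset.mem_filter, mem_gdtIndex, Finset.mem_Icc,
              Finset.mem_Ico, Finset.mem_range, Prod.mk.injEq, Sigma.mk.injEq, heq_eq_eq,
              true_and, and_true] <;> intro hi
          · omega
          · omega
          · omega
          · omega
          · rw [show i - 1 + 1 = i by omega, P.scomp_comm hc hu' ha hu φ ψ χ (l + 1 - r) i l
              (by omega) (by omega) (by omega)
              (by omega), LinearMap.map_smul_of_tower, LinearMap.smul_apply, sgn_smul_sgn_smul,
              sgn_congr (b := 0) (((q : ℤ) - 1) * ((r : ℤ) - 1)) (by ring)]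
            simp
      · refine Finset.sum_nbij' (fun z => ⟨z.2.1, z.2.2 + 1 - r, z.1⟩)
            (fun z => (z.2.2, z.1, z.2.1 + r - 1)) ?_ ?_ ?_ ?_ ?_ <;> rintro ⟨i, J, l⟩ <;>
            simp only [Finset.mem_sigma, Finset.mem_filter, mem_gdtIndex, Finset.mem_Icc,
              Finset.mem_Ico, Finset.mem_range, Prod.mk.injEq, Sigma.mk.injEq, heq_eq_eq,
              true_and, and_true] <;> intro hi
        · omega
        · omega
        · omega
        · omega
        · rw [P.scomp_comm hc hu' ha hu φ ψ χ (l + 1 - r) i l (by omega) (by omega) (by omega)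
              (by omega), LinearMap.map_smul_of_tower, LinearMap.smul_apply, sgn_smul_sgn_smul,
              sgn_congr (b := 0) (((q : ℤ) - 1) * ((r : ℤ) - 1)) (by ring)]
          simp
    · refine Finset.sum_nbij' (fun z => ⟨z.2.1, z.2.2, z.1 + q - 1⟩)
            (fun z => (z.2.2 + 1 - q, z.1, z.2.1)) ?_ ?_ ?_ ?_ ?_ <;> rintro ⟨i, J, l⟩ <;>
            simp only [Finset.mem_sigma, Finset.mem_filter, mem_gdtIndex, Finset.mem_Icc,
              Finset.mem_range, Prod.mk.injEq, Sigma.mk.injEq, heq_eq_eq, true_and, and_true] <;> intro hi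
      · omega
      · omega
      · omega
      · omega
      · rw [P.scomp_comm ha hu hc hu' φ χ ψ i l (i + q - 1) (by omega) (by omega) (by omega)
              (by omega), LinearMap.map_smul_of_tower, LinearMap.smul_apply]
        congr 1
        exact sgn_congr 0 (by ring)
  rw [h0, h1, gdtDisj, gdtMid, sgn_smul_sgn_smul,
    sgn_congr (b := 0) (((q : ℤ) - 1) * ((r : ℤ) - 1)) (by ring)]
  simp only [Finset.sum_add_distrib, sgn, Int.negOnePow_zero, one_smul]
  abel

end CyclicOppositeModule

/-! ### The corresponding expansions for S. -/

namespace CyclicOppositeModule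

variable {K : Type*} [CommRing K] {O : ℕ → Type*}
  [∀ n, AddCommGroup (O n)] [∀ n, Module K (O n)] {P : NSOperad K O} {N : ℕ → Type*}
  [∀ n, AddCommGroup (N n)] [∀ n, Module K (N n)] (M : CyclicOppositeModule P N)

/-- The operator `S_ψ` up to sign and before inserting the unit, in a fixed degree. -/
def cyc {q n m : ℕ} (h : m + q = n + 1) (ψ : O q) : N n →ₗ[K] N m :=
  ∑ j ∈ Finset.range m, ∑ k ∈ Finset.Icc (j + 1) m, M.sbul k h ψ ∘ₗ M.st n ^ j

theorem cyc_apply {q n m : ℕ} (h : m + q = n + 1) (ψ : O q) (x : N n) :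
    M.cyc h ψ x = ∑ j ∈ Finset.range m, ∑ k ∈ Finset.Icc (j + 1) m,
      M.sbul k h ψ ((M.st n ^ j) x) := by
  simp [cyc, LinearMap.sum_apply]

theorem cyc_zero {q n : ℕ} (h : 0 + q = n + 1) (ψ : O q) : M.cyc h ψ = 0 := by
  simp [cyc]

/-- The norm operator. -/
def norm (n : ℕ) : N n →ₗ[K] N n := ∑ a ∈ Finset.range (n + 1), M.st n ^ a

theorem norm_apply (n : ℕ) (x : N n) :
    M.norm n x = ∑ a ∈ Finset.range (n + 1), (M.st n ^ a) x := by
  simp [norm, LinearMap.sum_apply]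

/-- The index set of the terms of `φ S_ψ`: the triple `(i, J, k)` stands for `φ •_i ψ •_k t^J`. -/
def cycIndex (l m : ℕ) : Finset (ℕ × ℕ × ℕ) :=
  (Finset.range (m + 1) ×ˢ Finset.range l ×ˢ Finset.Icc 1 l).filter fun z => z.2.1 + 1 ≤ z.2.2

theorem mem_cycIndex {l m : ℕ} {z : ℕ × ℕ × ℕ} : z ∈ cycIndex l m ↔
    z.1 ≤ m ∧ z.2.1 + 1 ≤ z.2.2 ∧ z.2.2 ≤ l := by
  simp only [cycIndex, Finset.mem_filter, Finset.mem_product, Finset.mem_Icc, Finset.mem_range]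
  omega

/-- The terms of `φ S_ψ` in which `ψ` is not inserted into `φ`. -/
def cycOut {p q n l m : ℕ} (hl : l + q = n + 1) (hm : m + p = l + 1) (φ : O p) (ψ : O q)
    (x : N n) : N m :=
  ∑ z ∈ (cycIndex l m).filter (fun z => z.2.2 < z.1 ∨ z.1 + p ≤ z.2.2),
    M.sbul z.1 hm φ (M.sbul z.2.2 hl ψ ((M.st n ^ z.2.1) x))

/-- The terms of `φ S_ψ` in which `ψ` is inserted into `φ`. -/
def cycIn {p q n l m : ℕ} (hl : l + q = n + 1) (hm : m + p = l + 1) (φ : O p) (ψ : O q)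
    (x : N n) : N m :=
  ∑ z ∈ (cycIndex l m).filter (fun z => ¬ (z.2.2 < z.1 ∨ z.1 + p ≤ z.2.2)),
    M.sbul z.1 hm φ (M.sbul z.2.2 hl ψ ((M.st n ^ z.2.1) x))

/-- The terms of `S_ψ L_φ` in which `φ` is inserted into `ψ`. -/
def cycMid {p q n k m : ℕ} (hk : k + p = n + 1) (hm : m + q = k + 1) (φ : O p) (ψ : O q)
    (x : N n) : N m :=
  ∑ j ∈ Finset.range m, ∑ l ∈ Finset.Icc (j + 1) m, ∑ i ∈ Finset.Ico l (l + q),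
    M.sbul l hm ψ (M.sbul i hk φ ((M.st n ^ j) x))

theorem cycOut_eq_zero {p q n l : ℕ} (hl : l + q = n + 1) (hm : 0 + p = l + 1) (φ : O p)
    (ψ : O q) (x : N n) : M.cycOut hl hm φ ψ x = 0 := by
  refine Finset.sum_eq_zero fun z hz => ?_
  simp only [Finset.mem_filter, mem_cycIndex] at hz
  omega

theorem cycIn_eq_zero {q n l m : ℕ} (hl : l + q = n + 1) (hm : m + 0 = l + 1) (φ : O 0)
    (ψ : O q) (x : N n) : M.cycIn hl hm φ ψ x = 0 := by
  refine Finset.sum_eq_zero fun z hz => ?_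
  simp only [Finset.mem_filter, mem_cycIndex] at hz
  omega

theorem cycMid_eq_zero {p n k m : ℕ} (hk : k + p = n + 1) (hm : m + 0 = k + 1) (φ : O p)
    (ψ : O 0) (x : N n) : M.cycMid hk hm φ ψ x = 0 := by
  simp [cycMid]

theorem sum_sbul_cyc {p q n l m : ℕ} (hl : l + q = n + 1) (hm : m + p = l + 1) (φ : O p)
    (ψ : O q) (x : N n) :
    ∑ i ∈ Finset.range (m + 1), M.sbul i hm φ (M.cyc hl ψ x) =
      M.cycOut hl hm φ ψ x + M.cycIn hl hm φ ψ x := by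
  rw [cycOut, cycIn, Finset.sum_filter_add_sum_filter_not]
  simp only [cyc_apply, map_sum]
  simp only [Finset.sum_sigma']
  refine Finset.sum_nbij' (fun z => (z.1, z.2.1, z.2.2)) (fun z => ⟨z.1, z.2.1, z.2.2⟩)
    ?_ ?_ ?_ ?_ ?_
  · rintro ⟨i, j, k⟩
    simp only [Finset.mem_sigma, mem_cycIndex, Finset.mem_Icc, Finset.mem_range]
    omega
  · rintro ⟨i, j, k⟩
    simp only [Finset.mem_sigma, mem_cycIndex, Finset.mem_Icc, Finset.mem_range]
    omega
  · exact fun _ _ => rfl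
  · exact fun _ _ => rfl
  · exact fun _ _ => rfl

/-- If J < i, the composite φ ∘ ψ is inserted at a slot beyond J, a term of C for φ{ψ}. If J ≥ i,
the rotation t^i comes out in front and leaves a term of T(φ,ψ); summing over i ≤ m yields the norm.
-/
theorem cycIn_eq {p q c n l m : ℕ} (hl : l + q = n + 1) (hm : m + p = l + 1)
    (hc : c + 1 = p + q) (h : m + c = n + 1) (φ : O p) (ψ : O q) (x : N n) :
    M.cycIn hl hm φ ψ x = M.cyc h (P.sbrace hc φ ψ) x + M.norm m (M.gdt hc h φ ψ x) := by
  rw [cycIn, ← Finset.sum_filter_add_sum_filter_not _ (fun z => z.2.1 + 1 ≤ z.1)]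
  congr 1
  · rw [cyc_apply]
    simp only [NSOperad.sbrace, map_sum, LinearMap.sum_apply]
    simp only [Finset.sum_sigma']
    refine Finset.sum_nbij' (fun z => ⟨z.2.1, z.1, z.2.2 + 1 - z.1⟩)
      (fun z => (z.2.1, z.1, z.2.2 + z.2.1 - 1)) ?_ ?_ ?_ ?_ ?_ <;> rintro ⟨i, J, k⟩ <;>
      simp only [Finset.mem_sigma, Finset.mem_filter, mem_cycIndex, Finset.mem_Icc,
        Finset.mem_range, Prod.mk.injEq, Sigma.mk.injEq, heq_eq_eq, true_and] <;> intro hi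
    · omega
    · omega
    · omega
    · omega
    · rw [M.sbul_assoc hl hm hc h φ ψ _ i k (k + 1 - i)] <;> omega
  · rw [norm_apply, gdt_apply]
    simp only [map_sum]
    simp only [Finset.sum_sigma']
    refine Finset.sum_nbij' (fun z => ⟨z.1, z.2.1 - z.1, z.2.2 + 1 - z.1⟩)
      (fun z => (z.1, z.1 + z.2.1, z.2.2 + z.1 - 1)) ?_ ?_ ?_ ?_ ?_ <;> rintro ⟨i, J, k⟩ <;>
      simp only [Finset.mem_sigma, Finset.mem_filter, mem_cycIndex, Finset.mem_Icc,
        Finset.mem_range, Prod.mk.injEq, Sigma.mk.injEq, heq_eq_eq, true_and] <;> intro hi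
    · omega
    · omega
    · omega
    · omega
    · rw [M.sbul_assoc hl hm hc h φ ψ _ i k (k + 1 - i) (by omega) (by omega) (by omega)
          (by omega), M.st_pow_sbul _ _ _ _ _ (by omega), st_pow_st_pow, zero_add,
          show i + (J - i) = J by omega]

theorem cycMid_eq {p q c n k m : ℕ} (hk : k + p = n + 1) (hm : m + q = k + 1)
    (hc : c + 1 = q + p) (h : m + c = n + 1) (φ : O p) (ψ : O q) (x : N n) :
    M.cycMid hk hm φ ψ x = M.cyc h (P.sbrace hc ψ φ) x := by
  rw [cycMid, cyc_apply]
  simp only [NSOperad.sbrace, map_sum, LinearMap.sum_apply]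
  refine Finset.sum_congr rfl fun j hj => Finset.sum_congr rfl fun l hl => ?_
  simp only [Finset.mem_Icc] at hl
  refine Finset.sum_nbij' (fun i => i + 1 - l) (fun i => i + l - 1) ?_ ?_ ?_ ?_ ?_ <;>
    simp only [Finset.mem_Ico, Finset.mem_Icc] <;> intro i hi
  · omega
  · omega
  · omega
  · omega
  · rw [M.sbul_assoc hk hm hc h ψ φ _ l i (i + 1 - l)] <;> omega

/-- As in `gdt_lie`: φ either lands inside ψ or is disjoint from it, and in the disjoint case
exchanging the two gives the Out terms of Σ φ •_i C_ψ. -/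
theorem cyc_lie {p q n k l m : ℕ} (hk : k + p = n + 1) (hm : m + q = k + 1)
    (hl : l + q = n + 1) (hm' : m + p = l + 1) (φ : O p) (ψ : O q) (x : N n) :
    M.cyc hm ψ (M.lie hk φ x) = M.cycMid hk hm φ ψ x
      + sgn (((p : ℤ) - 1) * ((q : ℤ) - 1)) • M.cycOut hl hm' φ ψ x := by
  have h0 : M.cyc hm ψ (M.lie hk φ x) =
      ∑ j ∈ Finset.range m, ∑ l ∈ Finset.Icc (j + 1) m,
        (∑ c ∈ Finset.range j, M.sbul l hm ψ (M.sbul c hk φ ((M.st n ^ (j + p - 1)) x))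
        + ∑ J ∈ Finset.Ico j (j + p), M.sbul l hm ψ (M.sbul j hk φ ((M.st n ^ J) x))
        + (∑ c ∈ Finset.Ico (j + 1) l, M.sbul l hm ψ (M.sbul c hk φ ((M.st n ^ j) x))
          + ∑ c ∈ Finset.Ico l (l + q), M.sbul l hm ψ (M.sbul c hk φ ((M.st n ^ j) x))
          + ∑ c ∈ Finset.Icc (l + q) k, M.sbul l hm ψ (M.sbul c hk φ ((M.st n ^ j) x)))) := by
    rw [cyc_apply]
    refine Finset.sum_congr rfl fun j hj => Finset.sum_congr rfl fun l hl => ?_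
    simp only [Finset.mem_range, Finset.mem_Icc] at hj hl
    rw [M.st_pow_lie hk φ x j (by omega), map_add, map_add, map_sum, map_sum, map_sum]
    congr 1
    have : Finset.Icc (j + 1) k =
        (Finset.Ico (j + 1) l ∪ Finset.Ico l (l + q)) ∪ Finset.Icc (l + q) k := by
      ext i
      simp only [Finset.mem_union, Finset.mem_Icc, Finset.mem_Ico]
      omega
    rw [this, Finset.sum_union, Finset.sum_union]
    · rw [Finset.disjoint_left]
      intro i
      simp only [Finset.mem_Ico]
      omega
    · rw [Finset.disjoint_left]
      intro i
      simp only [Finset.mem_union, Finset.mem_Icc, Finset.mem_Ico]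
      omega
  have h1 : M.cycOut hl hm' φ ψ x = sgn (((p : ℤ) - 1) * ((q : ℤ) - 1)) •
      (∑ j ∈ Finset.range m, ∑ l ∈ Finset.Icc (j + 1) m, ∑ c ∈ Finset.range j,
        M.sbul l hm ψ (M.sbul c hk φ ((M.st n ^ (j + p - 1)) x))
      + ∑ j ∈ Finset.range m, ∑ l ∈ Finset.Icc (j + 1) m, ∑ J ∈ Finset.Ico j (j + p),
        M.sbul l hm ψ (M.sbul j hk φ ((M.st n ^ J) x))
      + ∑ j ∈ Finset.range m, ∑ l ∈ Finset.Icc (j + 1) m, ∑ c ∈ Finset.Ico (j + 1) l,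
        M.sbul l hm ψ (M.sbul c hk φ ((M.st n ^ j) x))
      + ∑ j ∈ Finset.range m, ∑ l ∈ Finset.Icc (j + 1) m, ∑ c ∈ Finset.Icc (l + q) k,
        M.sbul l hm ψ (M.sbul c hk φ ((M.st n ^ j) x))) := by
    have swap : ∀ i k' J, i < k' + 1 - p → k' + 1 - p ≤ m → p ≤ k' + 1 →
        M.sbul i hm' φ (M.sbul k' hl ψ ((M.st n ^ J) x)) =
        sgn (((p : ℤ) - 1) * ((q : ℤ) - 1)) •
          M.sbul (k' + 1 - p) hm ψ (M.sbul i hk φ ((M.st n ^ J) x)) := by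
      intro i k' J h1 h2 h3
      rw [M.sbul_comm hk hm hl hm' ψ φ _ (k' + 1 - p) i k' (by omega) (by omega) (by omega),
        sgn_smul_sgn_smul, sgn_congr (b := 0) (((p : ℤ) - 1) * ((q : ℤ) - 1)) (by ring)]
      simp
    -- With ψ to the right of φ, the rotation J lies beyond, inside or before the block i, …, i+p-1
    -- of φ; the fourth region has ψ to the left.
    rw [cycOut, ← Finset.sum_filter_add_sum_filter_not _ (fun z => z.2.2 < z.1), add_comm,
      ← Finset.sum_filter_add_sum_filter_not _ (fun z => z.2.1 < z.1), add_comm (∑ z ∈ _, _),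
      ← Finset.sum_filter_add_sum_filter_not _ (fun z => z.1 + p ≤ z.2.1),
      smul_add, smul_add, smul_add]
    simp only [Finset.sum_sigma', Finset.smul_sum]
    congr 1
    · congr 1
      · congr 1
        · refine Finset.sum_nbij' (fun z => ⟨z.2.1 + 1 - p, z.2.2 + 1 - p, z.1⟩)
            (fun z => (z.2.2, z.1 + p - 1, z.2.1 + p - 1)) ?_ ?_ ?_ ?_ ?_ <;> rintro ⟨i, J, l⟩ <;>
            simp only [Finset.mem_sigma, Finset.mem_filter, mem_cycIndex, Finset.mem_Icc,
              Finset.mem_range, Prod.mk.injEq, Sigma.mk.injEq, heq_eq_eq, true_and,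
              and_true] <;> intro hi
          · omega
          · omega
          · omega
          · omega
          · rw [swap i l J (by omega) (by omega) (by omega), show J + 1 - p + p - 1 = J by omega]
        · refine Finset.sum_nbij' (fun z => ⟨z.1, z.2.2 + 1 - p, z.2.1⟩)
            (fun z => (z.1, z.2.2, z.2.1 + p - 1)) ?_ ?_ ?_ ?_ ?_ <;> rintro ⟨i, J, l⟩ <;>
            simp only [Finset.mem_sigma, Finset.mem_filter, mem_cycIndex, Finset.mem_Icc,
              Finset.mem_Ico, Finset.mem_range, Prod.mk.injEq, Sigma.mk.injEq, heq_eq_eq,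
              true_and, and_true] <;> intro hi
          · omega
          · omega
          · omega
          · omega
          · rw [swap i l J (by omega) (by omega) (by omega)]
      · refine Finset.sum_nbij' (fun z => ⟨z.2.1, z.2.2 + 1 - p, z.1⟩)
            (fun z => (z.2.2, z.1, z.2.1 + p - 1)) ?_ ?_ ?_ ?_ ?_ <;> rintro ⟨i, J, l⟩ <;>
            simp only [Finset.mem_sigma, Finset.mem_filter, mem_cycIndex, Finset.mem_Icc,
              Finset.mem_Ico, Finset.mem_range, Prod.mk.injEq, Sigma.mk.injEq, heq_eq_eq,
              true_and, and_true] <;> intro hi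
        · omega
        · omega
        · omega
        · omega
        · rw [swap i l J (by omega) (by omega) (by omega)]
    · refine Finset.sum_nbij' (fun z => ⟨z.2.1, z.2.2, z.1 + q - 1⟩)
            (fun z => (z.2.2 + 1 - q, z.1, z.2.1)) ?_ ?_ ?_ ?_ ?_ <;> rintro ⟨i, J, l⟩ <;>
            simp only [Finset.mem_sigma, Finset.mem_filter, mem_cycIndex, Finset.mem_Icc,
              Finset.mem_range, Prod.mk.injEq, Sigma.mk.injEq, heq_eq_eq,
              true_and, and_true] <;> intro hi
      · omega
      · omega
      · omega
      · omega
      · rw [M.sbul_comm hl hm' hk hm φ ψ _ i l (i + q - 1) (by omega) (by omega) (by omega)]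
  rw [h0, h1, cycMid, sgn_smul_sgn_smul,
    sgn_congr (b := 0) (((p : ℤ) - 1) * ((q : ℤ) - 1)) (by ring)]
  simp only [Finset.sum_add_distrib, sgn, Int.negOnePow_zero, one_smul]
  abel

end CyclicOppositeModule

/-! ### The operators on the direct sum in terms of the signed ones. -/

namespace CyclicOppositeModule

variable {K : Type*} [CommRing K] {O : ℕ → Type*}
  [∀ n, AddCommGroup (O n)] [∀ n, Module K (O n)] {P : OperadWithMul K O} {N : ℕ → Type*}
  [∀ n, AddCommGroup (N n)] [∀ n, Module K (N n)] (M : CyclicOppositeModule P.toNSOperad N)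

theorem b_lof_zero (x : N 0) : M.b (DirectSum.lof K ℕ N 0 x) = 0 := by
  simp [b, DirectSum.toModule_lof]

/-- The first and last faces are the two terms of F_μ, the inner faces are E_μ. -/
theorem b_lof (n : ℕ) (x : N (n + 1)) :
    M.b (DirectSum.lof K ℕ N (n + 1) x) =
      DirectSum.lof K ℕ N n (M.lie (rfl : n + 2 = n + 1 + 1) P.mu x) := by
  simp only [b, DirectSum.toModule_lof, LinearMap.comp_apply, LinearMap.sum_apply,
    LinearMap.smul_apply]
  congr 1
  rw [lie, LinearMap.add_apply, lieE_apply, lieF_apply, Finset.sum_range_succ,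
    Finset.sum_range_succ', Finset.sum_range_succ, Finset.sum_range_one]
  have h1 : ∑ k ∈ Finset.range n, sgn ((k + 1 : ℕ) : ℤ) • M.face n (k + 1) x
      = ∑ i ∈ Finset.Icc 1 n, M.sbul i (rfl : n + 2 = n + 1 + 1) P.mu x := by
    refine Finset.sum_nbij' (fun i => i + 1) (fun i => i - 1) ?_ ?_ ?_ ?_ ?_ <;>
      simp only [Finset.mem_range, Finset.mem_Icc] <;> intro i hi
    · omega
    · omega
    · omega
    · omega
    · rw [face, if_pos (by omega), sbul_apply]
      congr 1
      exact sgn_congr 0 (by push_cast; ring)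
  rw [h1, add_assoc]
  congr 1
  simp [face, sbul_apply, st_apply, sgn]

theorem B_lof (n : ℕ) (x : N n) : M.B (DirectSum.lof K ℕ N n x) =
    DirectSum.lof K ℕ N (n + 1) (M.sbul 0 (rfl : n + 1 + 0 = n + 1) P.e (M.norm n x)) := by
  simp only [B, DirectSum.toModule_lof, LinearMap.comp_apply, LinearMap.sum_apply,
    LinearMap.smul_apply, norm_apply, map_sum, st_pow_apply, LinearMap.map_smul_of_tower,
    sbul_apply]
  simp [sgn]

theorem lieDeriv_lof {p n m : ℕ} (h : m + p = n + 1) (φ : O p) (x : N n) :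
    M.lieDeriv φ (DirectSum.lof K ℕ N n x) =
      DirectSum.lof K ℕ N m (sgn (p - 1) • M.lie h φ x) := by
  obtain rfl : m = n + 1 - p := by omega
  rw [lieDeriv, DirectSum.toModule_lof, dif_pos (by omega), LinearMap.comp_apply]
  congr 1
  simp only [LinearMap.add_apply, LinearMap.sum_apply, LinearMap.smul_apply, LinearMap.comp_apply,
    lie, lieE_apply, lieF_apply, smul_add, Finset.smul_sum]
  congr 1
  · refine Finset.sum_congr rfl fun i _ => ?_
    rw [sbul_apply, sgn_smul_sgn_smul]
    congr 1
    exact sgn_congr (-((p : ℤ) - 1)) (by ring)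
  · refine Finset.sum_nbij' (fun i => i - 1) (fun i => i + 1) ?_ ?_ ?_ ?_ ?_ <;>
      simp only [Finset.mem_range, Finset.mem_Icc] <;> intro i hi
    · omega
    · omega
    · omega
    · omega
    · rw [sbul_apply, st_pow_apply, LinearMap.map_smul_of_tower, sgn_smul_sgn_smul,
        sgn_smul_sgn_smul]
      congr 1
      have : ((i - 1 : ℕ) : ℤ) = i - 1 := by omega
      rw [this]
      exact sgn_congr 0 (by push_cast; ring)

theorem lieDeriv_lof_of_lt {p n : ℕ} (h : n + 1 < p) (φ : O p) (x : N n) :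
    M.lieDeriv φ (DirectSum.lof K ℕ N n x) = 0 := by
  rw [lieDeriv, DirectSum.toModule_lof, dif_neg (by omega), LinearMap.zero_apply]

/-- For first arity 2 only j = 0, k = 2 occurs, so contraction is a special case of T. -/
theorem gdt_mu {p c n m : ℕ} (hc : c + 1 = 2 + p) (h : m + c = n + 1) (φ : O p) (x : N n) :
    M.gdt hc h P.mu φ x = sgn (p - 1) • M.bul 0 h (P.comp 2 hc P.mu φ) x := by
  rw [gdt_apply]
  simp [Finset.sum_range_succ, sbul_apply, NSOperad.scomp_apply, sgn]

theorem contraction_lof {p c n m : ℕ} (hc : c + 1 = 2 + p) (h : m + c = n + 1) (φ : O p)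
    (x : N n) : M.contraction φ (DirectSum.lof K ℕ N n x) =
      DirectSum.lof K ℕ N m (sgn (p - 1) • M.gdt hc h P.mu φ x) := by
  obtain rfl : c = p + 1 := by omega
  obtain rfl : m = n - p := by omega
  rw [contraction, DirectSum.toModule_lof, dif_pos (by omega), LinearMap.comp_apply, gdt_mu,
    sgn_smul_sgn_smul, sgn_congr (b := 0) ((p : ℤ) - 1) (by ring)]
  simp [sgn]

theorem contraction_lof_of_lt {p n : ℕ} (h : n < p) (φ : O p) (x : N n) :
    M.contraction φ (DirectSum.lof K ℕ N n x) = 0 := by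
  rw [contraction, DirectSum.toModule_lof, dif_neg (by omega), LinearMap.zero_apply]

theorem cyclicHomotopy_lof {p n m : ℕ} (h : m + p = n + 1) (φ : O p) (x : N n) :
    M.cyclicHomotopy φ (DirectSum.lof K ℕ N n x) =
      DirectSum.lof K ℕ N (m + 1) (sgn (p - 1) •
        M.sbul 0 (rfl : m + 1 + 0 = m + 1) P.e (M.cyc h φ x)) := by
  rw [cyclicHomotopy, DirectSum.toModule_lof]
  -- m = 0 means p = n+1: the double sum is empty, in agreement with the convention that S vanishes
  -- there.
  rcases Nat.eq_zero_or_pos m with rfl | hm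
  · rw [dif_neg (by omega), cyc_zero]
    simp
  obtain rfl : m = n - p + 1 := by omega
  rw [dif_pos (by omega), LinearMap.comp_apply]
  congr 1
  simp only [LinearMap.sum_apply, LinearMap.smul_apply, LinearMap.comp_apply,
    cyc_apply, map_sum, Finset.smul_sum]
  simp only [Finset.sum_sigma']
  refine Finset.sum_nbij' (fun z => ⟨z.1 - 1, z.2⟩) (fun z => ⟨z.1 + 1, z.2⟩)
    ?_ ?_ ?_ ?_ ?_ <;> rintro ⟨i, k⟩ <;>
    simp only [Finset.mem_sigma, Finset.mem_Icc, Finset.mem_range, Sigma.mk.injEq, heq_eq_eq,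
      and_true] <;> intro hi
  · omega
  · omega
  · omega
  · omega
  · rw [sbul_apply, sbul_apply, st_pow_apply]
    simp only [LinearMap.map_smul_of_tower]
    simp only [sgn_smul_sgn_smul]
    congr 1
    have : ((i - 1 : ℕ) : ℤ) = i - 1 := by omega
    rw [this]
    exact sgn_congr (-((p : ℤ) - 1)) (by push_cast; ring)

theorem cyclicHomotopy_lof_of_lt {p n : ℕ} (h : n < p) (φ : O p) (x : N n) :
    M.cyclicHomotopy φ (DirectSum.lof K ℕ N n x) = 0 := by
  rw [cyclicHomotopy, DirectSum.toModule_lof, dif_neg (by omega), LinearMap.zero_apply]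

theorem gdtHomotopy_lof {p q c n m : ℕ} (hc : c + 1 = p + q) (h : m + c = n + 1) (φ : O p)
    (ψ : O q) (x : N n) : M.gdtHomotopy φ ψ (DirectSum.lof K ℕ N n x) =
      DirectSum.lof K ℕ N m (sgn (p * q) • M.gdt hc h φ ψ x) := by
  obtain rfl : c = p + q - 1 := by omega
  obtain rfl : m = n + 2 - (p + q) := by omega
  rw [gdtHomotopy, DirectSum.toModule_lof, dif_pos (by omega), LinearMap.comp_apply]
  congr 1
  simp only [LinearMap.sum_apply, LinearMap.smul_apply, LinearMap.comp_apply,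
    gdt_apply, Finset.smul_sum]
  simp only [Finset.sum_sigma']
  -- The new indices are the power of t and the slot p-i+j that receives ψ.
  refine Finset.sum_nbij' (fun z => ⟨z.1 - 1, p - z.2 + z.1⟩) (fun z => ⟨z.1 + 1, p + z.1 + 1 - z.2⟩)
    ?_ ?_ ?_ ?_ ?_ <;> rintro ⟨i, k⟩ <;>
    simp only [Finset.mem_sigma, Finset.mem_Icc, Finset.mem_range, Sigma.mk.injEq, heq_eq_eq] <;>
    intro hi
  · omega
  · omega
  · omega
  · omega
  · rw [sbul_apply, NSOperad.scomp_apply, st_pow_apply]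
    simp only [LinearMap.map_smul_of_tower, LinearMap.smul_apply]
    simp only [sgn_smul_sgn_smul]
    congr 1
    have : ((i - 1 : ℕ) : ℤ) = i - 1 := by omega
    have h2 : ((p - k + i : ℕ) : ℤ) = p - k + i := by omega
    rw [this, h2]
    exact sgn_congr (((q : ℤ) - 1) * (k - i - p + 1)) (by push_cast; ring)

theorem gdtHomotopy_lof_of_not {p q n : ℕ} (h : ¬ (1 ≤ p + q ∧ p + q ≤ n + 2)) (φ : O p)
    (ψ : O q) (x : N n) : M.gdtHomotopy φ ψ (DirectSum.lof K ℕ N n x) = 0 := by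
  rw [gdtHomotopy, DirectSum.toModule_lof, dif_neg h, LinearMap.zero_apply]

end CyclicOppositeModule

/-! ### The contraction identity. -/

theorem sgn_eq_ite (k : ℤ) : sgn k = if Even k then 1 else -1 := by
  split_ifs with h
  · exact Int.negOnePow_even k h
  · exact Int.negOnePow_odd k (Int.not_even_iff_odd.mp h)

namespace OperadWithMul

variable {K : Type*} [CommRing K] {O : ℕ → Type*}
  [∀ n, AddCommGroup (O n)] [∀ n, Module K (O n)] (P : OperadWithMul K O)

/-- Exhibits δφ as the bracket of μ with φ, so that T(δφ,ψ) and T(φ,δψ) fall under the brace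
expansions. -/
theorem delta_eq {p : ℕ} (φ : O p) : P.delta φ =
    P.sbrace (by omega : p + 1 + 1 = 2 + p) P.mu φ
      - sgn (p - 1) • P.sbrace (p := p) (q := 2) (r := p + 1) rfl φ P.mu := by
  have h1 : ∑ i ∈ Finset.Icc 1 p, sgn i • P.comp (p := p) (q := 2) (p - i + 1) rfl φ P.mu
      = - (sgn (p - 1) • P.sbrace (p := p) (q := 2) (r := p + 1) rfl φ P.mu) := by
    rw [NSOperad.sbrace, Finset.smul_sum, ← Finset.sum_neg_distrib]
    refine Finset.sum_nbij' (fun i => p - i + 1) (fun i => p + 1 - i) ?_ ?_ ?_ ?_ ?_ <;>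
      simp only [Finset.mem_Icc] <;> intro i hi
    · omega
    · omega
    · omega
    · omega
    · rw [NSOperad.scomp_apply, sgn_smul_sgn_smul, ← Units.neg_smul]
      congr 1
      have : ((p - i + 1 : ℕ) : ℤ) = p - i + 1 := by omega
      rw [this, sgn, sgn, ← Int.negOnePow_succ]
      exact sgn_congr (i - p) (by push_cast; ring)
  have h2 : P.sbrace (by omega : p + 1 + 1 = 2 + p) P.mu φ =
      P.comp 1 (by omega : p + 1 + 1 = 2 + p) P.mu φ
        + sgn (p + 1) • P.comp 2 (by omega : p + 1 + 1 = 2 + p) P.mu φ := by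
    rw [NSOperad.sbrace, show Finset.Icc 1 2 = {1, 2} from rfl, Finset.sum_pair (by decide),
      NSOperad.scomp_apply, NSOperad.scomp_apply]
    congr 1
    · simp [sgn]
    · congr 1
      exact sgn_congr (-1) (by push_cast; ring)
  rw [delta, h1, h2]
  abel

theorem bracket_eq {p q : ℕ} (h : p + q - 1 + 1 = p + q) (h' : p + q - 1 + 1 = q + p) (φ : O p)
    (ψ : O q) : P.bracket φ ψ = P.sbrace h φ ψ
      - sgn (((p : ℤ) - 1) * ((q : ℤ) - 1)) • P.sbrace h' ψ φ := by
  rw [bracket, dif_pos (by omega)]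
  rfl

end OperadWithMul

namespace CyclicOppositeModule

section

variable {K : Type*} [CommRing K] {O : ℕ → Type*}
  [∀ n, AddCommGroup (O n)] [∀ n, Module K (O n)] {P : NSOperad K O} {N : ℕ → Type*}
  [∀ n, AddCommGroup (N n)] [∀ n, Module K (N n)] (M : CyclicOppositeModule P N)

theorem gdt_sub_smul_left {p q c n m : ℕ} (hc : c + 1 = p + q) (h : m + c = n + 1) (φ φ' : O p)
    (u : ℤˣ) (ψ : O q) (x : N n) : M.gdt hc h (φ - u • φ') ψ x =
      M.gdt hc h φ ψ x - u • M.gdt hc h φ' ψ x := by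
  simp only [gdt_apply, map_sub, LinearMap.sub_apply, LinearMap.map_smul_of_tower,
    LinearMap.smul_apply, Finset.sum_sub_distrib, Finset.smul_sum]

theorem gdt_sub_smul_right {p q c n m : ℕ} (hc : c + 1 = p + q) (h : m + c = n + 1) (φ : O p)
    (u : ℤˣ) (ψ ψ' : O q) (x : N n) : M.gdt hc h φ (ψ - u • ψ') x =
      M.gdt hc h φ ψ x - u • M.gdt hc h φ ψ' x := by
  simp only [gdt_apply, map_sub, LinearMap.sub_apply, LinearMap.map_smul_of_tower,
    LinearMap.smul_apply, Finset.sum_sub_distrib, Finset.smul_sum]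

theorem gdt_eq_zero {p q c n m : ℕ} (hc : c + 1 = p + q) (h : m + c = n + 1) (φ : O p)
    (ψ : O q) (x : N n) (hp : p ≤ 1) : M.gdt hc h φ ψ x = 0 := by
  rw [gdt_apply]
  refine Finset.sum_eq_zero fun j _ => ?_
  rw [Finset.Icc_eq_empty (by omega), Finset.sum_empty]

theorem gdtOut_eq_zero {q r a u n m : ℕ} (ha : a + 1 = 1 + r) (hu : u + 1 = a + q)
    (hmu : m + u = n + 1) (φ : O 1) (ψ : O q) (χ : O r) (x : N n) :
    M.gdtOut ha hu hmu φ ψ χ x = 0 := by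
  refine Finset.sum_eq_zero fun z hz => ?_
  simp only [Finset.mem_filter, mem_gdtIndex] at hz
  omega

theorem gdtIn_eq_zero {p q a u n m : ℕ} (ha : a + 1 = p + 0) (hu : u + 1 = a + q)
    (hmu : m + u = n + 1) (φ : O p) (ψ : O q) (χ : O 0) (x : N n) :
    M.gdtIn ha hu hmu φ ψ χ x = 0 := by
  refine Finset.sum_eq_zero fun z hz => ?_
  simp only [Finset.mem_filter, mem_gdtIndex] at hz
  omega

theorem gdtMid_eq_zero {p r c u n m : ℕ} (hc : c + 1 = p + 0) (hu : u + 1 = c + r)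
    (hmu : m + u = n + 1) (φ : O p) (ψ : O 0) (χ : O r) (x : N n) :
    M.gdtMid hc hu hmu φ ψ χ x = 0 := by
  simp [gdtMid]

theorem lieF_zero {n m : ℕ} (h : m + 0 = n + 1) (φ : O 0) : M.lieF h φ = 0 := by
  simp [lieF]

end

variable {K : Type*} [CommRing K] {O : ℕ → Type*}
  [∀ n, AddCommGroup (O n)] [∀ n, Module K (O n)] {P : OperadWithMul K O} {N : ℕ → Type*}
  [∀ n, AddCommGroup (N n)] [∀ n, Module K (N n)] (M : CyclicOppositeModule P.toNSOperad N)

theorem gdtHomotopy_eq_zero {p q : ℕ} (φ : O p) (ψ : O q) (hp : p ≤ 1) :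
    M.gdtHomotopy φ ψ = 0 := by
  refine DirectSum.linearMap_ext K fun n => LinearMap.ext fun x => ?_
  rw [LinearMap.comp_apply, LinearMap.zero_comp, LinearMap.zero_apply]
  by_cases h : 1 ≤ p + q ∧ p + q ≤ n + 2
  · rw [M.gdtHomotopy_lof (by omega : p + q - 1 + 1 = p + q)
      (by omega : n + 2 - (p + q) + (p + q - 1) = n + 1), gdt_eq_zero _ _ _ _ _ _ hp]
    simp
  · exact M.gdtHomotopy_lof_of_not h φ ψ x

/-- The two expansions with χ = μ and Out eliminated. The element y stands for T(φ,ψ) b x up to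
sign; it is existential because for n = 0 there is no degree n-1 in which to write b x. -/
theorem gdtHomotopy_b {p q c l m u v w n : ℕ} (hu : u + 1 = p + 1 + q) (hmu : m + u = n + 1)
    (hc : c + 1 = p + q) (hl : l + c = n + 1) (hml : m + 2 = l + 1)
    (hv : v + 1 = 2 + q) (hv' : v + 1 = q + 2) (hu' : u + 1 = p + v)
    (hw : w + v = n + 1) (hm : m + p = w + 1) (hp : 1 ≤ p) (φ : O p) (ψ : O q) (x : N n) :
    ∃ y : N m, M.gdtHomotopy φ ψ (M.b (DirectSum.lof K ℕ N n x)) =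
        DirectSum.lof K ℕ N m (sgn (p * q) • y) ∧
      M.gdt hu hmu (P.sbrace (p := p) (q := 2) (r := p + 1) rfl φ P.mu) ψ x =
        M.gdt hu' hmu φ (P.sbrace hv P.mu ψ) x + M.lieF hm φ (M.gdt hv hw P.mu ψ x)
        + sgn (q - 1) • (y - sgn (p + q) • M.lieE hml P.mu (M.gdt hc hl φ ψ x)
          - M.gdt hu' hmu φ (P.sbrace hv' ψ P.mu) x) := by
  rw [gdt_sbrace_left, M.gdtIn_eq _ hu hmu hv hu' hw hm]
  rcases hp.eq_or_lt with rfl | hp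
  · refine ⟨0, ?_, ?_⟩
    -- For p = 1 both T(φ,ψ) and Out vanish, so y = 0 works, including n = 0; for p ≥ 2 the degrees
    -- force n ≥ 1.
    · rw [gdtHomotopy_eq_zero _ _ _ le_rfl]
      simp
    · simp [gdtOut_eq_zero, gdt_eq_zero]
  · obtain ⟨k, rfl⟩ : ∃ k, n = k + 1 := ⟨n - 1, by omega⟩
    refine ⟨M.gdt hc (by omega : m + c = k + 1) φ ψ (M.lie (rfl : k + 2 = k + 1 + 1) P.mu x), ?_, ?_⟩
    · rw [b_lof, M.gdtHomotopy_lof hc (by omega : m + c = k + 1)]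
    · rw [M.gdt_lie (p := p) (r := 2) (a := p + 1) rfl hu hmu rfl hc (by omega : m + c = k + 1) (by omega),
        M.gdtDisj_eq _ hc _ hl hml, M.gdtMid_eq hc _ hmu hv' hu']
      have h1 : sgn (((c : ℤ) - 1) * (((2 : ℕ) : ℤ) - 1)) = sgn (p + q) :=
        sgn_congr (-1) (by have : (c : ℤ) = p + q - 1 := by omega
                           rw [this]; push_cast; ring)
      have h2 : sgn (((q : ℤ) - 1) * (((2 : ℕ) : ℤ) - 1)) = sgn (q - 1) :=
        sgn_congr 0 (by push_cast; ring)
      rw [h1, h2]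
      simp only [smul_add, smul_sub, sgn_smul_sgn_smul]
      rw [sgn_congr (a := (q : ℤ) - 1 + (q - 1)) (b := 0) ((q : ℤ) - 1) (by ring)]
      simp only [sgn, Int.negOnePow_zero, one_smul]
      abel

/-- The identity for the contraction on a component of positive arity. -/
theorem contraction_homotopy_lof {p q n m : ℕ} (hp : 1 ≤ p) (h : m + (p + q) = n + 1) (φ : O p)
    (ψ : O q) (x : N n) :
    (gradedComm (-q) (1 - p) (M.contraction ψ) (M.lieDeriv φ)
        - M.contraction (P.bracket ψ φ)) (DirectSum.lof K ℕ N n x)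
      = (gradedComm (-1) (2 - p - q) M.b (M.gdtHomotopy φ ψ)
        + sgn (q - 1) • M.gdtHomotopy (P.delta φ) ψ
        + M.gdtHomotopy φ (P.delta ψ)) (DirectSum.lof K ℕ N n x) := by
  have hu : p + q + 1 = p + 1 + q := by omega
  have hc : q + p - 1 + 1 = p + q := by omega
  have hl : m + 1 + (q + p - 1) = n + 1 := by omega
  have hv : q + 1 + 1 = 2 + q := by omega
  have hw : m + p - 1 + (q + 1) = n + 1 := by omega
  have hm : m + p = m + p - 1 + 1 := by omega
  have hk : m + q + p = n + 1 := by omega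
  have hmk : m + (q + 1) = m + q + 1 := by omega
  -- The three inputs: T(φ{μ},ψ) from `gdtHomotopy_b`, then T(μ{φ},ψ) and T(μ,ψ) L_φ, which share
  -- one Out term.
  obtain ⟨y, hy1, hy2⟩ := M.gdtHomotopy_b hu h hc hl rfl hv rfl (rfl : p + q + 1 = p + (q + 1))
    hw hm hp φ ψ x
  have e2 := M.gdt_sbrace_left (by omega : p + 1 + 1 = 2 + p) hu h P.mu ψ φ x
  rw [M.gdtIn_eq _ hu h hc (by omega) hl rfl] at e2
  have e3 := M.gdt_lie (by omega : p + 1 + 1 = 2 + p) hu h hk hv hmk (by omega) P.mu ψ φ x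
  rw [M.gdtDisj_eq _ _ _ hw hm, M.gdtMid_eq hv _ h (by omega : q + p - 1 + 1 = q + p) (by omega)]
    at e3
  have hb : q + p - 1 + 1 = q + p := by omega
  have l3 : M.contraction (P.bracket ψ φ) (DirectSum.lof K ℕ N n x) =
      DirectSum.lof K ℕ N m (sgn (p + q) • M.gdt (c := p + q)
        (by omega : p + q + 1 = 2 + (q + p - 1)) h P.mu (P.sbrace hb ψ φ
          - sgn (((q : ℤ) - 1) * ((p : ℤ) - 1)) • P.sbrace (by omega) φ ψ) x) := by
    rw [M.contraction_lof (by omega : p + q + 1 = 2 + (q + p - 1)) h, P.bracket_eq hb (by omega)]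
    congr 2
    exact sgn_congr (-1) (by have : ((q + p - 1 : ℕ) : ℤ) = q + p - 1 := by omega
                             rw [this]; ring)
  simp only [gradedComm, LinearMap.sub_apply, LinearMap.add_apply, LinearMap.smul_apply,
    Module.End.mul_apply]
  rw [l3, hy1, M.lieDeriv_lof hk, M.contraction_lof hv hmk, M.contraction_lof hv hw,
    M.lieDeriv_lof hm, M.gdtHomotopy_lof hc hl, b_lof, M.gdtHomotopy_lof hu h,
    M.gdtHomotopy_lof (q := q + 1) (c := p + q) rfl h, P.delta_eq, P.delta_eq,
    gdt_sub_smul_left, gdt_sub_smul_right, gdt_sub_smul_right]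
  simp only [LinearMap.map_smul_of_tower]
  rw [hy2, e2, e3]
  -- With the shared Out term an atom, it remains to compare signs in the four parity cases of p and
  -- q.
  generalize hX : M.gdtOut (by omega : p + 1 + 1 = 2 + p) hu h P.mu ψ φ x = X
  simp only [lie, LinearMap.add_apply, map_add, map_sub, LinearMap.map_smul_of_tower]
  push_cast
  by_cases hp : Even (p : ℤ) <;> by_cases hq : Even (q : ℤ) <;>
    simp only [sgn_eq_ite, hp, hq, Int.even_add, Int.even_sub, Int.even_mul, even_neg,
      Int.not_even_one, even_two, if_true, if_false, iff_true, iff_false, not_true,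
      or_true, or_false, one_smul, Units.neg_smul, smul_sub, smul_add] <;>
    abel

end CyclicOppositeModule

namespace CyclicOppositeModule

variable {K : Type*} [CommRing K] {O : ℕ → Type*}
  [∀ n, AddCommGroup (O n)] [∀ n, Module K (O n)] {P : OperadWithMul K O} {N : ℕ → Type*}
  [∀ n, AddCommGroup (N n)] [∀ n, Module K (N n)] (M : CyclicOppositeModule P.toNSOperad N)

/-- The identity for the contraction on a component of arity zero. -/
theorem contraction_homotopy_zero_lof {q n m : ℕ} (h : m + q = n + 1) (φ : O 0)
    (ψ : O q) (x : N n) :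
    (gradedComm (-q) (1 - (0 : ℕ)) (M.contraction ψ) (M.lieDeriv φ)
        - M.contraction (P.bracket ψ φ)) (DirectSum.lof K ℕ N n x)
      = (gradedComm (-1) (2 - (0 : ℕ) - q) M.b (M.gdtHomotopy φ ψ)
        + sgn (q - 1) • M.gdtHomotopy (P.delta φ) ψ
        + M.gdtHomotopy φ (P.delta ψ)) (DirectSum.lof K ℕ N n x) := by
  have hu : q + 1 = 0 + 1 + q := by omega
  have hv : q + 1 + 1 = 2 + q := by omega
  have hk : m + q + 0 = n + 1 := by omega
  have hmk : m + (q + 1) = m + q + 1 := by omega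
  have hu' : q + 1 = q + 1 + 0 := rfl
  have ha : 0 + 1 + 1 = 2 + 0 := rfl
  have e2 := M.gdt_sbrace_left ha hu h P.mu ψ φ x
  rw [gdtIn_eq_zero, add_zero (M.gdtOut ha hu h P.mu ψ φ x)] at e2
  have e3 := M.gdt_lie ha hu h hk hv hmk hu' P.mu ψ φ x
  have e4 : P.sbrace (p := 0) (q := 2) (r := 0 + 1) rfl φ P.mu = 0 := by simp [NSOperad.sbrace]
  have l2 : M.lieDeriv φ (M.contraction ψ (DirectSum.lof K ℕ N n x)) =
      DirectSum.lof K ℕ N m (M.gdtDisj hk hv hmk P.mu ψ φ x) := by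
    -- For m = 0 the contraction already vanishes for degree reasons, and so does the disjoint part.
    -- For m > 0, L_φ is all E_φ, because an arity-0 operation cannot absorb the marked slot.
    rcases Nat.eq_zero_or_pos m with rfl | hm
    · rw [gdtDisj_eq_zero, M.contraction_lof_of_lt (by omega)]
      simp
    · obtain ⟨w, rfl⟩ : ∃ w, m = w + 1 := ⟨m - 1, by omega⟩
      have hw : w + (q + 1) = n + 1 := by omega
      have hm' : w + 1 + 0 = w + 1 := rfl
      rw [M.contraction_lof hv hw, M.lieDeriv_lof hm', M.gdtDisj_eq _ _ _ hw hm', lie, lieF_zero,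
        add_zero]
      simp only [LinearMap.map_smul_of_tower, sgn_smul_sgn_smul]
      congr 1
      exact sgn_congr (q - 1) (by push_cast; ring)
  have l3 : M.contraction (P.bracket ψ φ) (DirectSum.lof K ℕ N n x) =
      DirectSum.lof K ℕ N m (sgn q • M.gdtMid hv hu' h P.mu ψ φ x) := by
    rcases Nat.eq_zero_or_pos q with rfl | hq
    -- For p = q = 0 the true arity is -1; truncated subtraction puts the zero bracket in arity 0.
    · rw [gdtMid_eq_zero, OperadWithMul.bracket, dif_neg (by omega),
        M.contraction_lof (p := 0 + 0 - 1) (c := 1) (m := n) rfl rfl]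
      simp [gdt_apply]
    · have hb : q + 0 - 1 + 1 = q + 0 := by omega
      have e5 : P.sbrace (by omega : q + 0 - 1 + 1 = 0 + q) φ ψ = 0 := by simp [NSOperad.sbrace]
      rw [M.contraction_lof (by omega : q + 1 = 2 + (q + 0 - 1)) h, P.bracket_eq hb (by omega),
        M.gdtMid_eq hv _ h hb (by omega), e5, smul_zero, sub_zero]
      congr 2
      exact sgn_congr (-1) (by have : ((q + 0 - 1 : ℕ) : ℤ) = q - 1 := by omega
                               rw [this]; ring)
  simp only [gradedComm, LinearMap.sub_apply, LinearMap.add_apply, LinearMap.smul_apply,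
    Module.End.mul_apply]
  rw [l2, l3, M.lieDeriv_lof hk, M.contraction_lof hv hmk, gdtHomotopy_eq_zero _ φ _ zero_le_one,
    gdtHomotopy_eq_zero _ φ _ zero_le_one, M.gdtHomotopy_lof hu h, P.delta_eq, e4, smul_zero,
    sub_zero]
  simp only [LinearMap.map_smul_of_tower]
  rw [e2, e3]
  generalize M.gdtOut ha hu h P.mu ψ φ x = X
  simp only [map_add, LinearMap.map_smul_of_tower, LinearMap.zero_apply, map_zero, smul_zero]
  push_cast
  by_cases hq : Even (q : ℤ) <;>
    simp only [sgn_eq_ite, hq, Int.even_sub, Int.even_mul, even_neg,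
      Int.not_even_one, if_true, if_false, iff_false, not_true,
      or_true, or_false, one_smul, Units.neg_smul, smul_add] <;>
    abel

/-- Everything vanishes by degree. In the borderline case p+q = n+2 the value of T(φ,ψ) lies in
degree 0, where b is zero. -/
theorem contraction_homotopy_lof_of_lt {p q n : ℕ} (h : n + 1 < p + q) (φ : O p)
    (ψ : O q) (x : N n) :
    (gradedComm (-q) (1 - p) (M.contraction ψ) (M.lieDeriv φ)
        - M.contraction (P.bracket ψ φ)) (DirectSum.lof K ℕ N n x)
      = (gradedComm (-1) (2 - p - q) M.b (M.gdtHomotopy φ ψ)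
        + sgn (q - 1) • M.gdtHomotopy (P.delta φ) ψ
        + M.gdtHomotopy φ (P.delta ψ)) (DirectSum.lof K ℕ N n x) := by
  have l1 : M.contraction ψ (M.lieDeriv φ (DirectSum.lof K ℕ N n x)) = 0 := by
    by_cases hp : p ≤ n + 1
    · rw [M.lieDeriv_lof (by omega : n + 1 - p + p = n + 1), M.contraction_lof_of_lt (by omega)]
    · rw [M.lieDeriv_lof_of_lt (by omega), map_zero]
  have l2 : M.lieDeriv φ (M.contraction ψ (DirectSum.lof K ℕ N n x)) = 0 := by
    by_cases hq : q ≤ n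
    · rw [M.contraction_lof (by omega : q + 1 + 1 = 2 + q) (by omega : n - q + (q + 1) = n + 1),
        M.lieDeriv_lof_of_lt (by omega)]
    · rw [M.contraction_lof_of_lt (by omega), map_zero]
  have l3 : M.contraction (P.bracket ψ φ) (DirectSum.lof K ℕ N n x) = 0 :=
    M.contraction_lof_of_lt (by omega) _ _
  have l4 : M.b (M.gdtHomotopy φ ψ (DirectSum.lof K ℕ N n x)) = 0 := by
    by_cases hn : p + q ≤ n + 2
    · rw [M.gdtHomotopy_lof (by omega : n + 1 + 1 = p + q) (by omega : 0 + (n + 1) = n + 1),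
        b_lof_zero]
    · rw [M.gdtHomotopy_lof_of_not (by omega), map_zero]
  have l5 : M.gdtHomotopy φ ψ (M.b (DirectSum.lof K ℕ N n x)) = 0 := by
    rcases n with _ | n
    · rw [b_lof_zero, map_zero]
    · rw [b_lof, M.gdtHomotopy_lof_of_not (by omega)]
  simp only [gradedComm, LinearMap.sub_apply, LinearMap.add_apply, LinearMap.smul_apply,
    Module.End.mul_apply]
  rw [l1, l2, l3, l4, l5, M.gdtHomotopy_lof_of_not (by omega), M.gdtHomotopy_lof_of_not (by omega)]
  simp

theorem contraction_homotopy {p q : ℕ} (φ : O p) (ψ : O q) :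
    gradedComm (-q) (1 - p) (M.contraction ψ) (M.lieDeriv φ)
        - M.contraction (P.bracket ψ φ)
      = gradedComm (-1) (2 - p - q) M.b (M.gdtHomotopy φ ψ)
        + sgn (q - 1) • M.gdtHomotopy (P.delta φ) ψ
        + M.gdtHomotopy φ (P.delta ψ) := by
  refine DirectSum.linearMap_ext K fun n => LinearMap.ext fun x => ?_
  rw [LinearMap.comp_apply, LinearMap.comp_apply]
  by_cases h : p + q ≤ n + 1
  · obtain ⟨m, hm⟩ : ∃ m, m + (p + q) = n + 1 := ⟨n + 1 - (p + q), by omega⟩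
    rcases Nat.eq_zero_or_pos p with rfl | hp
    · exact M.contraction_homotopy_zero_lof (by omega : m + q = n + 1) φ ψ x
    · exact M.contraction_homotopy_lof hp hm φ ψ x
  · exact M.contraction_homotopy_lof_of_lt (by omega) φ ψ x

end CyclicOppositeModule

/-! ### Normalised operations are closed under δ and the bracket. -/

theorem units_smul_eq_zero {A : Type*} [AddCommGroup A] {u : ℤˣ} {x : A} (h : u • x = 0) :
    x = 0 := by
  rcases Int.units_eq_one_or u with rfl | rfl <;> simpa [Units.neg_smul] using h

namespace OperadWithMul

variable {K : Type*} [CommRing K] {O : ℕ → Type*}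
  [∀ n, AddCommGroup (O n)] [∀ n, Module K (O n)] {P : OperadWithMul K O}

theorem IsNormalized.scomp_e {p r : ℕ} {φ : O p} (hφ : P.IsNormalized φ) (i : ℕ)
    (h : r + 1 = p + 0) : P.scomp i h φ P.e = 0 := by
  rw [NSOperad.scomp_apply]
  by_cases hi : 1 ≤ i ∧ i ≤ p
  · have := hφ (p - i) r (by omega) h
    rw [show p - (p - i) = i by omega] at this
    rw [this, smul_zero]
  · rw [P.comp_eq_zero i h φ P.e (by omega), smul_zero]

theorem isNormalized_of_scomp_e {p : ℕ} {φ : O p}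
    (hφ : ∀ (i r : ℕ) (h : r + 1 = p + 0), 1 ≤ i → i ≤ p → P.scomp i h φ P.e = 0) :
    P.IsNormalized φ := fun j r hj h =>
  units_smul_eq_zero (hφ (p - j) r h (by omega) (by omega))

/-- A unit put into φ ∘_k ψ meets either a slot of φ other than k or a slot of ψ, and is killed in
both cases. -/
theorem IsNormalized.scomp {p q c : ℕ} {φ : O p} {ψ : O q} (hφ : P.IsNormalized φ)
    (hψ : P.IsNormalized ψ) {k : ℕ} (hk : 1 ≤ k) (hkp : k ≤ p) (hc : c + 1 = p + q) :
    P.IsNormalized (P.scomp k hc φ ψ) := by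
  refine isNormalized_of_scomp_e fun j r h hj hjc => ?_
  have hb : p - 1 + 1 = p + 0 := by omega
  rcases lt_or_ge j k with hjk | hjk
  · rw [P.scomp_comm hc h hb (by omega) φ ψ P.e k j (k - 1) hj hjk hkp (by omega),
      hφ.scomp_e, map_zero, LinearMap.zero_apply, smul_zero]
  rcases lt_or_ge j (q + k) with hjq | hjq
  · rw [P.scomp_assoc hc h (by omega : q - 1 + 1 = q + 0) (by omega) φ ψ P.e k j (j + 1 - k) hk
      hkp hjk hjq (by omega), hψ.scomp_e, map_zero]
  · have := P.scomp_comm hb (by omega) hc h φ P.e ψ (j + 1 - q) k j hk (by omega) (by omega)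
      (by omega)
    rw [hφ.scomp_e, map_zero, LinearMap.zero_apply] at this
    exact units_smul_eq_zero this.symm

theorem IsNormalized.sbrace {p q c : ℕ} {φ : O p} {ψ : O q} (hφ : P.IsNormalized φ)
    (hψ : P.IsNormalized ψ) (hc : c + 1 = p + q) : P.IsNormalized (P.sbrace hc φ ψ) := by
  refine isNormalized_of_scomp_e fun j r h hj hjc => ?_
  rw [NSOperad.sbrace, map_sum, LinearMap.sum_apply]
  refine Finset.sum_eq_zero fun k hk => ?_
  rw [Finset.mem_Icc] at hk
  exact (hφ.scomp hψ hk.1 hk.2 hc).scomp_e j h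

theorem IsNormalized.bracket {p q : ℕ} {φ : O p} {ψ : O q} (hφ : P.IsNormalized φ)
    (hψ : P.IsNormalized ψ) : P.IsNormalized (P.bracket φ ψ) := by
  by_cases h : 1 ≤ p + q
  · rw [P.bracket_eq (by omega) (by omega)]
    refine isNormalized_of_scomp_e fun j r h hj hjc => ?_
    rw [map_sub, LinearMap.sub_apply, (hφ.sbrace hψ _).scomp_e, LinearMap.map_smul_of_tower,
      LinearMap.smul_apply, (hψ.sbrace hφ _).scomp_e, smul_zero, sub_zero]
  · rw [OperadWithMul.bracket, dif_neg h]
    refine isNormalized_of_scomp_e fun j r h hj hjc => ?_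
    rw [map_zero, LinearMap.zero_apply]

theorem scomp_mu_e_one (h : 1 + 1 = 2 + 0) : P.scomp 1 h P.mu P.e = P.one := by
  rw [NSOperad.scomp_apply, ← P.mu_comp_one_e]
  simp [sgn]

/-- The unit has degree -1, so slot 2 carries a minus sign. This sign makes the later sums over unit
insertions telescope. -/
theorem scomp_mu_e_two (h : 1 + 1 = 2 + 0) : P.scomp 2 h P.mu P.e = -P.one := by
  rw [NSOperad.scomp_apply, ← P.mu_comp_two_e]
  simp [sgn, Units.neg_smul]

theorem scomp_one {p : ℕ} (i : ℕ) (h : p + 1 = p + 1) (φ : O p) (hi : 1 ≤ i) (hip : i ≤ p) :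
    P.scomp i h φ P.one = φ := by
  rw [NSOperad.scomp_apply, P.comp_one i φ hi hip]
  simp [sgn]

theorem scomp_one_left {p : ℕ} (h : p + 1 = 1 + p) (φ : O p) : P.scomp 1 h P.one φ = φ := by
  rw [NSOperad.scomp_apply, P.one_comp]
  simp [sgn]

/-- Only the two outermost slots can meet an input of μ directly; every other slot belongs to φ. -/
theorem IsNormalized.sbrace_mu_left_e {p : ℕ} {φ : O p} (hφ : P.IsNormalized φ)
    (hc : p + 1 + 1 = 2 + p) (h : p + 1 = p + 1 + 0) {j : ℕ} (hj : 1 ≤ j) (hjp : j ≤ p + 1) :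
    P.scomp j h (P.sbrace hc P.mu φ) P.e =
      (if j = p + 1 then sgn p • φ else 0) + (if j = 1 then sgn (p - 1) • φ else 0) := by
  rw [NSOperad.sbrace, show Finset.Icc 1 2 = {1, 2} from rfl, Finset.sum_pair (by decide),
    map_add, LinearMap.add_apply]
  congr 1
  · split_ifs with hj'
    · have h2 : 1 + 1 = 2 + 0 := rfl
      have := P.scomp_comm h2 (by omega : p + 1 = 1 + p) hc h P.mu P.e φ 2 1 j
        le_rfl (by omega) le_rfl (by omega)
      rw [scomp_mu_e_two, map_neg, LinearMap.neg_apply, scomp_one_left] at this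
      have h3 (a : ℤ) (y : O p) : y = sgn a • sgn a • y := by
        rw [sgn_smul_sgn_smul, sgn_congr (b := 0) a (by ring)]
        simp [sgn]
      rw [h3 _ (P.scomp j h (P.scomp 1 hc P.mu φ) P.e), ← this, smul_neg, ← Units.neg_smul, sgn,
        ← Int.negOnePow_succ]
      congr 1
      exact sgn_congr (1 - p) (by push_cast; ring)
    · rw [P.scomp_assoc hc h (by omega : p - 1 + 1 = p + 0) (by omega) P.mu φ P.e 1 j j le_rfl
        (by omega) hj (by omega) rfl, hφ.scomp_e, map_zero]
  · split_ifs with hj'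
    · subst hj'
      rw [P.scomp_comm hc h (rfl : 1 + 1 = 2 + 0) (by omega : p + 1 = 1 + p) P.mu φ P.e 2 1 1
        le_rfl (by omega) le_rfl rfl, scomp_mu_e_one, scomp_one_left]
      congr 1
      exact sgn_congr (-((p : ℤ) - 1)) (by push_cast; ring)
    · rw [P.scomp_assoc hc h (by omega : p - 1 + 1 = p + 0) (by omega) P.mu φ P.e 2 j (j - 1)
        (by omega) le_rfl (by omega) (by omega) (by omega), hφ.scomp_e, map_zero]

/-- The two inputs of μ contribute φ with opposite signs, from i = j and i = j-1. They cancel except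
at the ends j = 1 and j = p+1. -/
theorem IsNormalized.sbrace_mu_right_e {p : ℕ} {φ : O p} (hφ : P.IsNormalized φ)
    (hc : p + 1 + 1 = p + 2) (h : p + 1 = p + 1 + 0) {j : ℕ} (hj : 1 ≤ j) (hjp : j ≤ p + 1) :
    P.scomp j h (P.sbrace hc φ P.mu) P.e =
      (if j ≤ p then φ else 0) - (if 2 ≤ j then φ else 0) := by
  have key : ∀ i ∈ Finset.Icc 1 p, P.scomp j h (P.scomp i hc φ P.mu) P.e =
      (if i = j then φ else 0) - (if i = j - 1 then φ else 0) := by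
    intro i hi
    rw [Finset.mem_Icc] at hi
    have hb : p - 1 + 1 = p + 0 := by omega
    rcases lt_trichotomy j i with hji | rfl | hji
    · rw [P.scomp_comm hc h hb (by omega) φ P.mu P.e i j (i - 1) hj hji hi.2 (by omega),
        hφ.scomp_e, map_zero, LinearMap.zero_apply, smul_zero, if_neg (by omega),
        if_neg (by omega), sub_zero]
    · rw [P.scomp_assoc hc h (rfl : 1 + 1 = 2 + 0) rfl φ P.mu P.e j j 1 hj hi.2 le_rfl (by omega)
        (by omega), scomp_mu_e_one, scomp_one _ _ _ hj hi.2, if_pos rfl, if_neg (by omega),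
        sub_zero]
    · rw [if_neg (by omega)]
      by_cases hj' : i = j - 1
      · rw [P.scomp_assoc hc h (rfl : 1 + 1 = 2 + 0) rfl φ P.mu P.e i j 2 hi.1 hi.2 hji.le
          (by omega) (by omega), scomp_mu_e_two, map_neg, scomp_one _ _ _ hi.1 hi.2, if_pos hj',
          zero_sub]
      · have := P.scomp_comm hb (by omega) hc h φ P.e P.mu (j - 1) i j hi.1 (by omega)
          (by omega) (by omega)
        rw [hφ.scomp_e, map_zero, LinearMap.zero_apply] at this
        rw [units_smul_eq_zero this.symm, if_neg hj', sub_zero]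
  rw [NSOperad.sbrace, map_sum, LinearMap.sum_apply, Finset.sum_congr rfl key,
    Finset.sum_sub_distrib, Finset.sum_ite_eq', Finset.sum_ite_eq']
  simp only [Finset.mem_Icc]
  congr 1
  · simp [hj]
  · exact if_congr (by omega) rfl rfl

/-- The end terms of μ{φ} and of φ{μ} cancel each other. -/
theorem IsNormalized.delta {p : ℕ} {φ : O p} (hφ : P.IsNormalized φ) :
    P.IsNormalized (P.delta φ) := by
  refine isNormalized_of_scomp_e fun j r h hj hjp => ?_
  obtain rfl : r = p := by omega
  rw [P.delta_eq, map_sub, LinearMap.sub_apply, LinearMap.map_smul_of_tower,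
    LinearMap.smul_apply, hφ.sbrace_mu_left_e _ h hj hjp, hφ.sbrace_mu_right_e _ h hj hjp,
    smul_sub]
  have hs : sgn (r : ℤ) = - sgn ((r : ℤ) - 1) := by
    rw [sgn, sgn, ← Int.negOnePow_succ, sub_add_cancel]
  rw [hs, Units.neg_smul]
  simp only [smul_ite, smul_zero]
  generalize sgn ((r : ℤ) - 1) • φ = y
  split_ifs <;> first | omega | simp

end OperadWithMul

/-! ### Descent to the normalised complex. -/

namespace CyclicOppositeModule

variable {K : Type*} [CommRing K] {O : ℕ → Type*}
  [∀ n, AddCommGroup (O n)] [∀ n, Module K (O n)] {P : OperadWithMul K O} {N : ℕ → Type*}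
  [∀ n, AddCommGroup (N n)] [∀ n, Module K (N n)] (M : CyclicOppositeModule P.toNSOperad N)

/-- The degenerate elements of degree `m`. -/
def degenerateAt (m : ℕ) : Submodule K (N m) := M.degenerate.comap (DirectSum.lof K ℕ N m)

theorem units_smul_mem {A : Type*} [AddCommGroup A] [Module K A] (S : Submodule K A) {x : A}
    (u : ℤˣ) (hx : x ∈ S) : u • x ∈ S := by
  rcases Int.units_eq_one_or u with rfl | rfl
  · simpa using hx
  · simpa [Units.neg_smul] using hx

theorem sbul_e_mem {n m : ℕ} (h : m + 0 = n + 1) {j : ℕ} (hj : 1 ≤ j) (x : N n) :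
    M.sbul j h P.e x ∈ M.degenerateAt m := by
  obtain rfl : m = n + 1 := h
  by_cases hjm : j ≤ n + 1
  · rw [sbul_apply]
    refine units_smul_mem _ _ (Submodule.subset_span ⟨n, j - 1, x, by omega, ?_⟩)
    rw [degen, show j - 1 + 1 = j by omega]
  · rw [M.sbul_eq_zero _ _ _ _ (by omega)]
    exact zero_mem _

theorem descends_of_sbul_e {F : Module.End K (⨁ n, N n)}
    (hF : ∀ (n j : ℕ) (x : N n), 1 ≤ j → j ≤ n + 1 →
      F (DirectSum.lof K ℕ N (n + 1) (M.sbul j (rfl : n + 1 + 0 = n + 1) P.e x)) ∈ M.degenerate) :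
    M.Descends F := by
  refine Submodule.span_le.mpr ?_
  rintro _ ⟨n, j, x, hj, rfl⟩
  -- Scaling x beforehand undoes the Koszul sign of the unit insertion.
  have := hF n (j + 1) (sgn (((0 : ℕ) - 1 : ℤ) * (j + 1 : ℕ)) • x) (by omega) (by omega)
  rw [LinearMap.map_smul_of_tower, sbul_apply, sgn_smul_sgn_smul,
    sgn_congr (b := 0) (-(j + 1)) (by push_cast; ring), sgn, Int.negOnePow_zero, one_smul] at this
  exact this

/-- An operation that vanishes on the unit maps insertions of the unit to such insertions. -/
theorem sbul_sbul_e {p n k m : ℕ} (hk : k + 0 = n + 1) (hm : m + p = k + 1) (θ : O p) (x : N n)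
    (i j : ℕ) (hθ : ∀ (r : ℕ) (hr : r + 1 = p + 0), i ≤ j → j < i + p →
      P.scomp (j + 1 - i) hr θ P.e = 0) :
    M.sbul i hm θ (M.sbul j hk P.e x) = 0 ∨ ∃ (j' l : ℕ) (h : m + 0 = l + 1) (y : N l),
      (i = 0 ∨ 1 ≤ j → 1 ≤ j') ∧ M.sbul i hm θ (M.sbul j hk P.e x) = M.sbul j' h P.e y := by
  by_cases hi : i ≤ m
  swap
  · exact Or.inl (M.sbul_eq_zero _ _ _ _ (by omega))
  by_cases hjk : j ≤ k
  swap
  · rw [M.sbul_eq_zero j _ _ _ (by omega), map_zero]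
    exact Or.inl rfl
  rcases lt_or_ge j i with hji | hij
  · refine Or.inr ⟨j, m - 1, by omega, sgn (((p : ℤ) - 1) * (((0 : ℕ) : ℤ) - 1)) •
      M.sbul (i - 1) (by omega) θ x, by omega, ?_⟩
    rw [M.sbul_comm hk hm (by omega : m - 1 + p = n + 1) (by omega) θ P.e x i j (i - 1) hji hi
      (by omega), LinearMap.map_smul_of_tower]
  rcases lt_or_ge j (i + p) with hjp | hjp
  · left
    rw [M.sbul_assoc hk hm (by omega : p - 1 + 1 = p + 0) (by omega) θ P.e x i j (j + 1 - i) hjp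
      hij hi (by omega), hθ _ _ hij hjp, map_zero, LinearMap.zero_apply]
  · refine Or.inr ⟨j + 1 - p, m - 1, by omega, sgn ((((0 : ℕ) : ℤ) - 1) * ((p : ℤ) - 1)) •
      M.sbul i (by omega) θ x, by omega, ?_⟩
    rw [LinearMap.map_smul_of_tower,
      M.sbul_comm (by omega : m - 1 + p = n + 1) (by omega) hk hm P.e θ x (j + 1 - p) i j
      (by omega) (by omega) (by omega), sgn_smul_sgn_smul,
      sgn_congr (b := 0) ((((0 : ℕ) : ℤ) - 1) * ((p : ℤ) - 1)) (by ring), sgn,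
      Int.negOnePow_zero, one_smul]

theorem sbul_sbul_e_mem {p n k m : ℕ} (hk : k + 0 = n + 1) (hm : m + p = k + 1) (θ : O p)
    (x : N n) (i j : ℕ) (hθ : ∀ (r : ℕ) (hr : r + 1 = p + 0), i ≤ j → j < i + p →
      P.scomp (j + 1 - i) hr θ P.e = 0) (hij : i = 0 ∨ 1 ≤ j) :
    M.sbul i hm θ (M.sbul j hk P.e x) ∈ M.degenerateAt m := by
  obtain h | ⟨j', l, h, y, hj', hy⟩ := M.sbul_sbul_e hk hm θ x i j hθ
  · rw [h]
    exact zero_mem _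
  · rw [hy]
    exact M.sbul_e_mem h (hj' hij) y

theorem sbul_sbul_e_mem_of_isNormalized {p n k m : ℕ} (hk : k + 0 = n + 1) (hm : m + p = k + 1)
    {θ : O p} (hθ : P.IsNormalized θ) (x : N n) (i j : ℕ) (hij : i = 0 ∨ 1 ≤ j) :
    M.sbul i hm θ (M.sbul j hk P.e x) ∈ M.degenerateAt m :=
  M.sbul_sbul_e_mem hk hm θ x i j (fun _ hr _ _ => hθ.scomp_e _ hr) hij

theorem isNormalized_e : P.IsNormalized P.e := fun _ _ hj => absurd hj (Nat.not_lt_zero _)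

/-- Rotation preserves the form of a unit insertion, but j' may be 0, which is not a degeneracy. -/
theorem st_pow_sbul_e {n m : ℕ} (h : m + 0 = n + 1) (x : N n) {j : ℕ} (hj : j ≤ m) (a : ℕ) :
    ∃ (j' b : ℕ), j' ≤ m ∧
      (M.st m ^ a) (M.sbul j h P.e x) = M.sbul j' h P.e ((M.st n ^ b) x) := by
  induction a with
  | zero => exact ⟨j, 0, hj, rfl⟩
  | succ a ih =>
    obtain ⟨j', b, hj', hb⟩ := ih
    rw [pow_succ', Module.End.mul_apply, hb]
    rcases hj'.eq_or_lt with rfl | hj'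
    · refine ⟨0, b, Nat.zero_le _, ?_⟩
      have := M.st_pow_sbul_wrap h P.e ((M.st n ^ b) x) j' 1 0 0 le_rfl (by omega) (by omega) rfl
      rwa [pow_one, pow_zero, Module.End.one_apply] at this
    · refine ⟨j' + 1, b + 1, hj', ?_⟩
      rw [M.st_sbul _ _ _ _ hj', pow_succ', Module.End.mul_apply]

/-- A unit rotated into slot 0 is harmless under θ •_0: it is killed by θ, or, if θ has arity 0,
pushed to slot 1. -/
theorem sbul_zero_st_pow_sbul_e_mem {p n k m : ℕ} (hk : k + 0 = n + 1) (hm : m + p = k + 1)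
    {θ : O p} (hθ : P.IsNormalized θ) (x : N n) {j : ℕ} (hj : j ≤ k) (a : ℕ) :
    M.sbul 0 hm θ ((M.st k ^ a) (M.sbul j hk P.e x)) ∈ M.degenerateAt m := by
  obtain ⟨j', b, -, h⟩ := M.st_pow_sbul_e hk x hj a
  rw [h]
  exact M.sbul_sbul_e_mem_of_isNormalized hk hm hθ _ 0 j' (Or.inl rfl)

theorem descends_lieDeriv {p : ℕ} {φ : O p} (hφ : P.IsNormalized φ) :
    M.Descends (M.lieDeriv φ) := by
  refine M.descends_of_sbul_e fun n j x hj hjn => ?_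
  by_cases hp : p ≤ n + 1 + 1
  · rw [M.lieDeriv_lof (by omega : n + 1 + 1 - p + p = n + 1 + 1), lie, LinearMap.add_apply,
      lieE_apply, lieF_apply]
    refine units_smul_mem (M.degenerateAt _) _ (add_mem (sum_mem fun i _ => ?_)
      (sum_mem fun l _ => ?_))
    · exact M.sbul_sbul_e_mem_of_isNormalized _ _ hφ _ _ _ (Or.inr hj)
    · exact M.sbul_zero_st_pow_sbul_e_mem _ _ hφ _ hjn _
  · rw [M.lieDeriv_lof_of_lt (by omega)]
    exact zero_mem _

theorem descends_gdtHomotopy {p q : ℕ} {φ : O p} {ψ : O q} (hφ : P.IsNormalized φ)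
    (hψ : P.IsNormalized ψ) : M.Descends (M.gdtHomotopy φ ψ) := by
  refine M.descends_of_sbul_e fun n j x hj hjn => ?_
  by_cases hp : 1 ≤ p + q ∧ p + q ≤ n + 1 + 2
  · rw [M.gdtHomotopy_lof (by omega : p + q - 1 + 1 = p + q)
      (by omega : n + 1 + 2 - (p + q) + (p + q - 1) = n + 1 + 1), gdt_apply]
    refine units_smul_mem (M.degenerateAt _) _ (sum_mem fun a _ => sum_mem fun k hk => ?_)
    rw [Finset.mem_Icc] at hk
    exact M.sbul_zero_st_pow_sbul_e_mem _ _ (hφ.scomp hψ (by omega) hk.2 _) _ hjn _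
  · rw [M.gdtHomotopy_lof_of_not hp]
    exact zero_mem _

theorem descends_cyclicHomotopy {p : ℕ} {φ : O p} (hφ : P.IsNormalized φ) :
    M.Descends (M.cyclicHomotopy φ) := by
  refine M.descends_of_sbul_e fun n j x hj hjn => ?_
  by_cases hp : p ≤ n + 1
  · rw [M.cyclicHomotopy_lof (by omega : n + 1 + 1 - p + p = n + 1 + 1), cyc_apply, map_sum]
    refine units_smul_mem (M.degenerateAt _) _ (sum_mem fun a _ => ?_)
    rw [map_sum]
    refine sum_mem fun k _ => ?_
    obtain ⟨j', b, -, h⟩ := M.st_pow_sbul_e (rfl : n + 1 + 0 = n + 1) x hjn a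
    rw [h]
    -- The unit may still sit in slot 0 here; the outer e •_0 moves it to a positive slot.
    obtain h | ⟨l, l', h', y, -, hy⟩ := M.sbul_sbul_e (rfl : n + 1 + 0 = n + 1)
      (by omega : n + 1 + 1 - p + p = n + 1 + 1) φ ((M.st n ^ b) x) k j'
      (fun _ hr _ _ => hφ.scomp_e _ hr)
    · rw [h, map_zero]
      exact zero_mem _
    · rw [hy]
      exact M.sbul_sbul_e_mem_of_isNormalized _ _ isNormalized_e _ 0 l (Or.inl rfl)
  · rw [M.cyclicHomotopy_lof_of_lt (by omega)]
    exact zero_mem _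

theorem descends_B : M.Descends M.B := by
  refine M.descends_of_sbul_e fun n j x hj hjn => ?_
  rw [B_lof, norm_apply, map_sum]
  exact sum_mem (S := M.degenerateAt _) fun a _ =>
    M.sbul_zero_st_pow_sbul_e_mem _ _ isNormalized_e _ hjn _

theorem descends_contraction {p : ℕ} {φ : O p} (hφ : P.IsNormalized φ) :
    M.Descends (M.contraction φ) := by
  refine M.descends_of_sbul_e fun n j x hj hjn => ?_
  by_cases hp : p ≤ n + 1
  · have hc : p + 1 + 1 = 2 + p := by omega
    rw [M.contraction_lof hc (by omega : n + 1 - p + (p + 1) = n + 1 + 1), gdt_apply]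
    refine units_smul_mem (M.degenerateAt _) _ (sum_mem fun a _ => sum_mem fun k hk => ?_)
    rw [Finset.mem_Icc] at hk
    obtain rfl : a = 0 := by omega
    obtain rfl : k = 2 := by omega
    rw [pow_zero, Module.End.one_apply]
    refine M.sbul_sbul_e_mem _ _ _ _ _ _ (fun r hr _ hjp => ?_) (Or.inl rfl)
    -- μ ∘_2 φ need not be normalised at its first slot. Since j ≥ 1, the unit enters slot j+1 ≥ 2,
    -- which belongs to φ.
    rw [P.scomp_assoc hc hr (by omega : p - 1 + 1 = p + 0) (by omega) P.mu φ P.e 2 (j + 1 - 0) j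
      (by omega) le_rfl (by omega) (by omega) (by omega), hφ.scomp_e, map_zero]
  · rw [M.contraction_lof_of_lt (by omega)]
    exact zero_mem _

theorem sbul_one {n : ℕ} (i : ℕ) (h : n + 1 = n + 1) (x : N n) (hi : i ≤ n) :
    M.sbul i h P.one x = x := by
  rw [sbul_apply, M.one_bul i x hi]
  simp [sgn]

theorem sbul_mu_sbul_e_sub_mem {n : ℕ} (hk : n + 1 + 0 = n + 1) (hm : n + 2 = n + 1 + 1)
    (x : N n) {i j : ℕ} (hi : i ≤ n) (hij : i = 0 ∨ 1 ≤ j) :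
    M.sbul i hm P.mu (M.sbul j hk P.e x) -
      ((if i = j then x else 0) - (if i + 1 = j then x else 0)) ∈ M.degenerateAt n := by
  by_cases h1 : i = j
  · subst h1
    rw [M.sbul_assoc hk hm (rfl : 1 + 1 = 2 + 0) rfl P.mu P.e x i i 1 (by omega) le_rfl hi
      (by omega), P.scomp_mu_e_one, M.sbul_one _ _ _ hi]
    simp
  by_cases h2 : i + 1 = j
  · subst h2
    rw [M.sbul_assoc hk hm (rfl : 1 + 1 = 2 + 0) rfl P.mu P.e x i (i + 1) 2 (by omega) (by omega)
      hi (by omega), P.scomp_mu_e_two, map_neg, LinearMap.neg_apply, M.sbul_one _ _ _ hi]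
    simp
  rw [if_neg h1, if_neg h2, sub_zero, sub_zero]
  exact M.sbul_sbul_e_mem hk hm P.mu x i j (fun _ _ _ _ => by omega) hij

/-- Modulo degenerate elements, the unit at slot j survives only under its two neighbouring faces,
which give x and -x. For j = n+1 the last face supplies the x, after the unit wraps to slot 0. -/
theorem descends_b : M.Descends M.b := by
  refine M.descends_of_sbul_e fun n j x hj hjn => ?_
  have hm : n + 2 = n + 1 + 1 := rfl
  have hk : n + 1 + 0 = n + 1 := rfl
  have h1 : M.sbul 0 hm P.mu (M.st (n + 1) (M.sbul j hk P.e x)) -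
      (if n + 1 = j then x else 0) ∈ M.degenerateAt n := by
    by_cases hj' : j + 1 ≤ n + 1
    · rw [M.st_sbul _ _ _ _ hj', if_neg (by omega)]
      simpa [show j ≠ 0 by omega] using M.sbul_mu_sbul_e_sub_mem hk hm (M.st n x) (Nat.zero_le n)
        (Or.inl rfl : 0 = 0 ∨ 1 ≤ j + 1)
    · obtain rfl : j = n + 1 := by omega
      have := M.st_pow_sbul_wrap hk P.e x (n + 1) 1 0 0 le_rfl (by omega) (by omega) rfl
      rw [pow_one, pow_zero, Module.End.one_apply] at this
      rw [this]
      simpa using M.sbul_mu_sbul_e_sub_mem hk hm x (Nat.zero_le n) (Or.inl rfl : 0 = 0 ∨ 1 ≤ 0)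
  have h2 : ∑ i ∈ Finset.range (n + 1), (M.sbul i hm P.mu (M.sbul j hk P.e x) -
      ((if i = j then x else 0) - (if i = j - 1 then x else 0))) ∈ M.degenerateAt n := by
    refine sum_mem fun i hi => ?_
    have := M.sbul_mu_sbul_e_sub_mem hk hm x (Finset.mem_range_succ_iff.mp hi)
      (Or.inr hj : i = 0 ∨ 1 ≤ j)
    rwa [if_congr (by omega : i + 1 = j ↔ i = j - 1) rfl rfl] at this
  have h3 := add_mem h2 h1
  rw [Finset.sum_sub_distrib, Finset.sum_sub_distrib, Finset.sum_ite_eq', Finset.sum_ite_eq'] at h3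
  rw [b_lof]
  change M.lie hm P.mu _ ∈ M.degenerateAt n
  convert h3 using 1
  rw [if_pos (Finset.mem_range.mpr (by omega : j - 1 < n + 1)), lie, LinearMap.add_apply,
    lieE_apply, lieF_apply, Finset.sum_range_succ, Finset.sum_range_one, Finset.sum_range_succ',
    pow_zero, pow_one, Module.End.one_apply]
  have h4 : ∑ i ∈ Finset.Icc 1 n, M.sbul i hm P.mu (M.sbul j hk P.e x) =
      ∑ i ∈ Finset.range n, M.sbul (i + 1) hm P.mu (M.sbul j hk P.e x) := by
    rw [Finset.range_eq_Ico, Finset.sum_Ico_add' (fun i => M.sbul i hm P.mu (M.sbul j hk P.e x))]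
    rfl
  rw [h4]
  simp only [Finset.mem_range]
  split_ifs <;> first | omega | (simp; abel)

end CyclicOppositeModule

/-! ### The identity for S, and assembly on the quotient. -/

namespace CyclicOppositeModule

variable {K : Type*} [CommRing K] {O : ℕ → Type*}
  [∀ n, AddCommGroup (O n)] [∀ n, Module K (O n)] {P : OperadWithMul K O} {N : ℕ → Type*}
  [∀ n, AddCommGroup (N n)] [∀ n, Module K (N n)] (M : CyclicOppositeModule P.toNSOperad N)

theorem sbul_zero_st_pow_sbul_zero_e {p l k m : ℕ} (hk : k + 0 = l + 1) (hm : m + p = k + 1)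
    (θ : O p) (y : N l) {a : ℕ} (ha : a < p)
    (hθ : ∀ (r : ℕ) (hr : r + 1 = p + 0), P.scomp (a + 1) hr θ P.e = 0) :
    M.sbul 0 hm θ ((M.st k ^ a) (M.sbul 0 hk P.e y)) = 0 := by
  rw [M.st_pow_sbul _ _ _ _ _ (by omega), zero_add,
    M.sbul_assoc hk hm (by omega : p - 1 + 1 = p + 0) (by omega) θ P.e _ 0 a (a + 1) (by omega)
      (Nat.zero_le _) (Nat.zero_le _) rfl, hθ, map_zero, LinearMap.zero_apply]

theorem lieF_sbul_e {p l k m : ℕ} (hk : k + 0 = l + 1) (hm : m + p = k + 1)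
    {φ : O p} (hφ : P.IsNormalized φ) (y : N l) :
    M.lieF hm φ (M.sbul 0 hk P.e y) = 0 := by
  rw [lieF_apply]
  refine Finset.sum_eq_zero fun a ha => ?_
  exact M.sbul_zero_st_pow_sbul_zero_e hk hm φ y (Finset.mem_range.mp ha)
    fun _ hr => hφ.scomp_e _ hr

/-- Rotation puts the unit into slot a+1 of φ ∘_j ψ. As j ≥ a+2, that slot lies left of ψ, hence is
a slot of φ. -/
theorem gdt_sbul_e {p q c l k m : ℕ} (hk : k + 0 = l + 1) (hc : c + 1 = p + q)
    (hm : m + c = k + 1) {φ : O p} (hφ : P.IsNormalized φ) (ψ : O q) (y : N l) :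
    M.gdt hc hm φ ψ (M.sbul 0 hk P.e y) = 0 := by
  rw [gdt_apply]
  refine Finset.sum_eq_zero fun a ha => Finset.sum_eq_zero fun j hj => ?_
  rw [Finset.mem_Icc] at hj
  refine M.sbul_zero_st_pow_sbul_zero_e hk hm _ y (by omega) fun r hr => ?_
  have hb : p - 1 + 1 = p + 0 := by omega
  rw [P.scomp_comm hc hr hb (by omega) φ ψ P.e j (a + 1) (j - 1) (by omega) (by omega) hj.2
    (by omega), hφ.scomp_e, map_zero, LinearMap.zero_apply, smul_zero]

/-- F_φ kills e •_0 y, and E_φ commutes past the unit with all slots shifted down by one. The sum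
therefore includes slot 0. -/
theorem lie_sbul_e {p l k m m' : ℕ} (hk : k + 0 = l + 1) (hm : m' + p = k + 1)
    (hm' : m + p = l + 1) (h : m' + 0 = m + 1) {φ : O p} (hφ : P.IsNormalized φ) (y : N l) :
    M.lie hm φ (M.sbul 0 hk P.e y) = sgn (p - 1) • M.sbul 0 h P.e
      (∑ i ∈ Finset.range (m + 1), M.sbul i hm' φ y) := by
  rw [lie, LinearMap.add_apply, M.lieF_sbul_e hk hm hφ, add_zero, lieE_apply, map_sum,
    Finset.smul_sum]
  refine Finset.sum_nbij' (fun i => i - 1) (fun i => i + 1) ?_ ?_ ?_ ?_ ?_ <;>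
    simp only [Finset.mem_range, Finset.mem_Icc] <;> intro i hi
  · omega
  · omega
  · omega
  · omega
  · rw [M.sbul_comm hk hm hm' h φ P.e y i 0 (i - 1) (by omega) hi.2 (by omega)]
    congr 1
    exact sgn_congr (1 - p) (by push_cast; ring)

theorem cyc_sub_smul {q n m : ℕ} (h : m + q = n + 1) (u : ℤˣ) (ψ ψ' : O q) (x : N n) :
    M.cyc h (ψ - u • ψ') x = M.cyc h ψ x - u • M.cyc h ψ' x := by
  simp only [cyc_apply, map_sub, LinearMap.sub_apply, LinearMap.map_smul_of_tower,
    LinearMap.smul_apply, Finset.sum_sub_distrib, Finset.smul_sum]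

theorem cyclicHomotopy_zero {p : ℕ} : M.cyclicHomotopy (0 : O p) = 0 := by
  refine DirectSum.linearMap_ext K fun n => LinearMap.ext fun x => ?_
  rw [LinearMap.comp_apply, LinearMap.zero_comp, LinearMap.zero_apply]
  by_cases h : p ≤ n + 1
  · rw [M.cyclicHomotopy_lof (by omega : n + 1 - p + p = n + 1), cyc_apply]
    simp
  · rw [M.cyclicHomotopy_lof_of_lt (by omega)]

theorem gdtHomotopy_B {p q : ℕ} {φ : O p} (hφ : P.IsNormalized φ) (ψ : O q) :
    M.gdtHomotopy φ ψ * M.B = 0 := by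
  refine DirectSum.linearMap_ext K fun n => LinearMap.ext fun x => ?_
  rw [LinearMap.comp_apply, LinearMap.zero_comp, LinearMap.zero_apply, Module.End.mul_apply, B_lof]
  by_cases h : 1 ≤ p + q ∧ p + q ≤ n + 1 + 2
  · rw [M.gdtHomotopy_lof (by omega : p + q - 1 + 1 = p + q)
      (by omega : n + 1 + 2 - (p + q) + (p + q - 1) = n + 1 + 1), M.gdt_sbul_e _ _ _ hφ]
    simp
  · rw [M.gdtHomotopy_lof_of_not h]

theorem lieDeriv_cyclicHomotopy_lof {p q n l m : ℕ} (hl : l + q = n + 1) (hm : m + p = l + 1)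
    {φ : O p} (hφ : P.IsNormalized φ) (ψ : O q) (x : N n) :
    M.lieDeriv φ (M.cyclicHomotopy ψ (DirectSum.lof K ℕ N n x)) =
      DirectSum.lof K ℕ N (m + 1) (sgn (q - 1) • M.sbul 0 (rfl : m + 1 + 0 = m + 1) P.e
        (M.cycOut hl hm φ ψ x + M.cycIn hl hm φ ψ x)) := by
  rw [M.cyclicHomotopy_lof hl, M.lieDeriv_lof (by omega : m + 1 + p = l + 1 + 1),
    LinearMap.map_smul_of_tower, LinearMap.map_smul_of_tower, M.lie_sbul_e _ _ hm rfl hφ,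
    M.sum_sbul_cyc]
  simp only [LinearMap.map_smul_of_tower, sgn_smul_sgn_smul]
  congr 1
  exact sgn_congr (p - 1) (by ring)

theorem cyclicHomotopy_lieDeriv_lof {p q n k l m : ℕ} (hk : k + p = n + 1) (hm : m + q = k + 1)
    (hl : l + q = n + 1) (hm' : m + p = l + 1) (φ : O p) (ψ : O q) (x : N n) :
    M.cyclicHomotopy ψ (M.lieDeriv φ (DirectSum.lof K ℕ N n x)) =
      DirectSum.lof K ℕ N (m + 1) (sgn (p + q) • M.sbul 0 (rfl : m + 1 + 0 = m + 1) P.e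
        (M.cycMid hk hm φ ψ x
          + sgn (((p : ℤ) - 1) * ((q : ℤ) - 1)) • M.cycOut hl hm' φ ψ x)) := by
  rw [M.lieDeriv_lof hk, M.cyclicHomotopy_lof hm, LinearMap.map_smul_of_tower,
    LinearMap.map_smul_of_tower, M.cyc_lie hk hm hl hm']
  simp only [LinearMap.map_smul_of_tower, sgn_smul_sgn_smul]
  congr 1
  exact sgn_congr (-1) (by ring)

/-- The identity for `S` on a component whose image has positive degree. -/
theorem cyclicHomotopy_homotopy_lof {p q n m : ℕ} (h : m + 1 + (p + q) = n + 2) {φ : O p}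
    (hφ : P.IsNormalized φ) (ψ : O q) (x : N n) :
    (gradedComm (2 - q) (1 - p) (M.cyclicHomotopy ψ) (M.lieDeriv φ)
        - M.cyclicHomotopy (P.bracket ψ φ)) (DirectSum.lof K ℕ N n x)
      = gradedComm 1 (2 - p - q) M.B (M.gdtHomotopy φ ψ) (DirectSum.lof K ℕ N n x) := by
  have hk : m + q + p = n + 1 := by omega
  have hm : m + 1 + q = m + q + 1 := by omega
  have hl : m + p + q = n + 1 := by omega
  have hm' : m + 1 + p = m + p + 1 := by omega
  rw [gradedComm, gradedComm, M.gdtHomotopy_B hφ]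
  simp only [LinearMap.sub_apply, LinearMap.smul_apply, Module.End.mul_apply, smul_zero,
    sub_zero]
  rw [M.lieDeriv_cyclicHomotopy_lof hl hm' hφ, M.cyclicHomotopy_lieDeriv_lof hk hm hl hm']
  by_cases hpq : 1 ≤ p + q
  · have hb : q + p - 1 + 1 = q + p := by omega
    have hb' : q + p - 1 + 1 = p + q := by omega
    have hc : m + 1 + (q + p - 1) = n + 1 := by omega
    rw [M.cycMid_eq hk hm hb hc, M.cycIn_eq hl hm' hb' hc, M.cyclicHomotopy_lof hc,
      M.gdtHomotopy_lof hb' hc, B_lof, P.bracket_eq hb hb', cyc_sub_smul,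
      show ((q + p - 1 : ℕ) : ℤ) = q + p - 1 by omega]
    -- Both products contain this same Out term; signs decide the rest.
    generalize M.cycOut hl hm' φ ψ x = X
    simp only [map_add, map_sub, LinearMap.map_smul_of_tower]
    by_cases hp : Even (p : ℤ) <;> by_cases hq : Even (q : ℤ) <;>
      simp only [sgn_eq_ite, hp, hq, Int.even_add, Int.even_sub, Int.even_mul,
        Int.not_even_one, even_two, if_true, if_false, iff_true, iff_false, not_true,
        or_true, or_false, one_smul, Units.neg_smul, smul_sub, smul_add] <;>
      abel
  · obtain rfl : p = 0 := by omega
    obtain rfl : q = 0 := by omega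
    rw [cycMid_eq_zero, cycIn_eq_zero, OperadWithMul.bracket, dif_neg (by omega),
      cyclicHomotopy_zero, gdtHomotopy_eq_zero _ _ _ zero_le_one]
    generalize M.cycOut hl hm' φ ψ x = X
    simp only [map_add, map_zero, LinearMap.zero_apply, LinearMap.map_smul_of_tower]
    simp [sgn_eq_ite, Units.neg_smul]

/-- S_ψ L_φ and the bracket term vanish by degree. For p+q = n+2 the value of T(φ,ψ) lies in degree
0, where L_φ S_ψ reduces to ± B T(φ,ψ); beyond that, both remaining terms vanish. -/
theorem cyclicHomotopy_homotopy_lof_of_le {p q n : ℕ} (h : n + 2 ≤ p + q) {φ : O p}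
    (hφ : P.IsNormalized φ) (ψ : O q) (x : N n) :
    (gradedComm (2 - q) (1 - p) (M.cyclicHomotopy ψ) (M.lieDeriv φ)
        - M.cyclicHomotopy (P.bracket ψ φ)) (DirectSum.lof K ℕ N n x)
      = gradedComm 1 (2 - p - q) M.B (M.gdtHomotopy φ ψ) (DirectSum.lof K ℕ N n x) := by
  have l1 : M.cyclicHomotopy ψ (M.lieDeriv φ (DirectSum.lof K ℕ N n x)) = 0 := by
    by_cases hp : p ≤ n + 1
    · rw [M.lieDeriv_lof (by omega : n + 1 - p + p = n + 1), M.cyclicHomotopy_lof_of_lt (by omega)]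
    · rw [M.lieDeriv_lof_of_lt (by omega), map_zero]
  have l3 : M.cyclicHomotopy (P.bracket ψ φ) (DirectSum.lof K ℕ N n x) = 0 :=
    M.cyclicHomotopy_lof_of_lt (by omega) _ _
  rw [gradedComm, gradedComm, M.gdtHomotopy_B hφ]
  simp only [LinearMap.sub_apply, LinearMap.smul_apply, Module.End.mul_apply, smul_zero,
    sub_zero]
  rw [l1, l3, sub_zero, zero_sub]
  rcases h.eq_or_lt with h | h
  · have hc : n + 1 + 1 = p + q := by omega
    have hn : 0 + (n + 1) = n + 1 := by omega
    rw [M.gdtHomotopy_lof hc hn, B_lof]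
    rcases Nat.eq_zero_or_pos p with rfl | hp
    · rw [M.cyclicHomotopy_lof_of_lt (by omega), gdt_eq_zero _ _ _ _ _ _ zero_le_one]
      simp
    · have hl : p - 1 + q = n + 1 := by omega
      have hm : 0 + p = p - 1 + 1 := by omega
      rw [M.lieDeriv_cyclicHomotopy_lof hl hm hφ, cycOut_eq_zero, M.cycIn_eq hl hm hc hn,
        cyc_zero, LinearMap.zero_apply, zero_add (M := N 0), zero_add (M := N 0)]
      simp only [LinearMap.map_smul_of_tower]
      rw [sgn_smul_sgn_smul, ← Units.neg_smul, sgn, sgn, ← Int.negOnePow_succ]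
      congr 1
      exact sgn_congr (1 - p) (by ring)
  · have l2 : M.lieDeriv φ (M.cyclicHomotopy ψ (DirectSum.lof K ℕ N n x)) = 0 := by
      by_cases hq : q ≤ n + 1
      · have hl : n + 1 - q + q = n + 1 := by omega
        rw [M.cyclicHomotopy_lof hl]
        -- This leaves only p+q = n+3: the target has degree 0, so E_φ is empty and F_φ kills e •_0.
        by_cases hp : p ≤ n + 1 - q + 1 + 1
        · have hm : 0 + p = n + 1 - q + 1 + 1 := by omega
          rw [M.lieDeriv_lof hm, LinearMap.map_smul_of_tower, LinearMap.map_smul_of_tower, lie,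
            LinearMap.add_apply, M.lieF_sbul_e _ _ hφ, lieE_apply]
          simp
        · rw [M.lieDeriv_lof_of_lt (by omega)]
      · rw [M.cyclicHomotopy_lof_of_lt (by omega), map_zero]
    rw [l2, M.gdtHomotopy_lof_of_not (by omega)]
    simp

theorem cyclicHomotopy_homotopy {p q : ℕ} {φ : O p} (hφ : P.IsNormalized φ) (ψ : O q) :
    gradedComm (2 - q) (1 - p) (M.cyclicHomotopy ψ) (M.lieDeriv φ)
        - M.cyclicHomotopy (P.bracket ψ φ)
      = gradedComm 1 (2 - p - q) M.B (M.gdtHomotopy φ ψ) := by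
  refine DirectSum.linearMap_ext K fun n => LinearMap.ext fun x => ?_
  rw [LinearMap.comp_apply, LinearMap.comp_apply]
  by_cases h : n + 2 ≤ p + q
  · exact M.cyclicHomotopy_homotopy_lof_of_le h hφ ψ x
  · exact M.cyclicHomotopy_homotopy_lof (by omega : n + 1 - (p + q) + 1 + (p + q) = n + 2) hφ ψ x

/-! ### Operators on the normalised complex -/

variable {M} {F G : Module.End K (⨁ n, N n)}

theorem Descends.induced_mk (hF : M.Descends F) (x : ⨁ n, N n) :
    M.induced F (M.degenerate.mkQ x) = M.degenerate.mkQ (F x) := by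
  rw [induced, dif_pos hF]
  rfl

theorem Descends.gradedComm_induced_mk (hF : M.Descends F) (hG : M.Descends G) (a c : ℤ)
    (x : ⨁ n, N n) : gradedComm a c (M.induced F) (M.induced G) (M.degenerate.mkQ x) =
      M.degenerate.mkQ (gradedComm a c F G x) := by
  simp only [gradedComm, LinearMap.sub_apply, LinearMap.smul_apply, Module.End.mul_apply,
    hF.induced_mk, hG.induced_mk, map_sub, LinearMap.map_smul_of_tower]

end CyclicOppositeModule

theorem gradedComm_add_left {K V : Type*} [CommRing K] [AddCommGroup V] [Module K V] (a c : ℤ)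
    (F F' G : Module.End K V) :
    gradedComm a c (F + F') G = gradedComm a c F G + gradedComm a c F' G := by
  simp only [gradedComm, add_mul, mul_add, smul_add]
  abel

theorem gradedComm_congr {K V : Type*} [CommRing K] [AddCommGroup V] [Module K V] {a c a' : ℤ}
    (k : ℤ) (h : a = a' + 2 * k) (F G : Module.End K V) :
    gradedComm a c F G = gradedComm a' c F G := by
  rw [gradedComm, gradedComm, sgn_congr (b := a' * c) (k * c) (by rw [h]; ring)]

end

theorem theoremB {K : Type*} [Field K] [CharZero K] {O : ℕ → Type*}
    [∀ n, AddCommGroup (O n)] [∀ n, Module K (O n)] (P : OperadWithMul K O) {N : ℕ → Type*}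
    [∀ n, AddCommGroup (N n)] [∀ n, Module K (N n)]
    (M : CyclicOppositeModule P.toNSOperad N) :
    -- the identity for the contraction, on the whole of `N`
    (∀ (p q : ℕ) (φ : O p) (ψ : O q),
      gradedComm (-q) (1 - p) (M.contraction ψ) (M.lieDeriv φ)
          - M.contraction (P.bracket ψ φ)
        = gradedComm (-1) (2 - p - q) M.b (M.gdtHomotopy φ ψ)
          + sgn (q - 1) • M.gdtHomotopy (P.delta φ) ψ
          + M.gdtHomotopy φ (P.delta ψ)) ∧
    -- all operators involved are defined on the normalised complex
    M.Descends M.b ∧ M.Descends M.B ∧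
    (∀ (p : ℕ) (φ : O p), P.IsNormalized φ → P.IsNormalized (P.delta φ) ∧
      M.Descends (M.contraction φ) ∧ M.Descends (M.lieDeriv φ) ∧
      M.Descends (M.cyclicHomotopy φ)) ∧
    (∀ (p q : ℕ) (φ : O p) (ψ : O q), P.IsNormalized φ → P.IsNormalized ψ →
      P.IsNormalized (P.bracket ψ φ) ∧ M.Descends (M.gdtHomotopy φ ψ) ∧
      -- the identity for the operator `S`, on the normalised complex
      gradedComm (2 - q) (1 - p) (M.induced (M.cyclicHomotopy ψ)) (M.induced (M.lieDeriv φ))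
          - M.induced (M.cyclicHomotopy (P.bracket ψ φ))
        = gradedComm 1 (2 - p - q) (M.induced M.B) (M.induced (M.gdtHomotopy φ ψ)) ∧
      -- the full homotopy formula, on the normalised complex
      gradedComm (-q) (1 - p)
            (M.induced (M.contraction ψ) + M.induced (M.cyclicHomotopy ψ))
            (M.induced (M.lieDeriv φ))
          - M.induced (M.contraction (P.bracket ψ φ))
          - M.induced (M.cyclicHomotopy (P.bracket ψ φ))
        = gradedComm 1 (2 - p - q) (M.induced M.b + M.induced M.B)
            (M.induced (M.gdtHomotopy φ ψ))
          + sgn (q - 1) • M.induced (M.gdtHomotopy (P.delta φ) ψ)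
          + M.induced (M.gdtHomotopy φ (P.delta ψ))) := by
  have hid (p q : ℕ) (φ : O p) (ψ : O q) (hφ : P.IsNormalized φ) (hψ : P.IsNormalized ψ) :
      gradedComm (2 - q) (1 - p) (M.induced (M.cyclicHomotopy ψ)) (M.induced (M.lieDeriv φ))
          - M.induced (M.cyclicHomotopy (P.bracket ψ φ))
        = gradedComm 1 (2 - p - q) (M.induced M.B) (M.induced (M.gdtHomotopy φ ψ)) := by
    refine Submodule.linearMap_qext _ (LinearMap.ext fun x => ?_)
    rw [LinearMap.comp_apply, LinearMap.comp_apply, LinearMap.sub_apply,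
      (M.descends_cyclicHomotopy hψ).gradedComm_induced_mk (M.descends_lieDeriv hφ),
      (M.descends_cyclicHomotopy (hψ.bracket hφ)).induced_mk,
      M.descends_B.gradedComm_induced_mk (M.descends_gdtHomotopy hφ hψ),
      ← M.cyclicHomotopy_homotopy hφ ψ, LinearMap.sub_apply, map_sub]
  refine ⟨fun p q φ ψ => M.contraction_homotopy φ ψ, M.descends_b, M.descends_B,
    fun p φ hφ => ⟨hφ.delta, M.descends_contraction hφ, M.descends_lieDeriv hφ,
      M.descends_cyclicHomotopy hφ⟩,
    fun p q φ ψ hφ hψ => ⟨hψ.bracket hφ, M.descends_gdtHomotopy hφ hψ, hid p q φ ψ hφ hψ, ?_⟩⟩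
  have h1 : gradedComm (-q) (1 - p) (M.induced (M.contraction ψ)) (M.induced (M.lieDeriv φ))
        - M.induced (M.contraction (P.bracket ψ φ))
      = gradedComm (-1) (2 - p - q) (M.induced M.b) (M.induced (M.gdtHomotopy φ ψ))
        + sgn (q - 1) • M.induced (M.gdtHomotopy (P.delta φ) ψ)
        + M.induced (M.gdtHomotopy φ (P.delta ψ)) := by
    refine Submodule.linearMap_qext _ (LinearMap.ext fun x => ?_)
    rw [LinearMap.comp_apply, LinearMap.comp_apply, LinearMap.sub_apply, LinearMap.add_apply,
      LinearMap.add_apply, LinearMap.smul_apply,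
      (M.descends_contraction hψ).gradedComm_induced_mk (M.descends_lieDeriv hφ),
      (M.descends_contraction (hψ.bracket hφ)).induced_mk,
      M.descends_b.gradedComm_induced_mk (M.descends_gdtHomotopy hφ hψ),
      (M.descends_gdtHomotopy hφ.delta hψ).induced_mk,
      (M.descends_gdtHomotopy hφ hψ.delta).induced_mk, ← LinearMap.map_smul_of_tower, ← map_sub,
      ← map_add, ← map_add, ← LinearMap.sub_apply, M.contraction_homotopy φ ψ]
    simp only [LinearMap.add_apply, LinearMap.smul_apply]
  have h2 := hid p q φ ψ hφ hψ
  -- Degrees 2-q and -q, and likewise -1 and 1, have equal parity, so the two identities can be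
  -- added.
  rw [gradedComm_congr (a' := -q) 1 (by ring)] at h2
  rw [gradedComm_congr (a := -1) (a' := 1) (-1) (by ring)] at h1
  rw [gradedComm_add_left, gradedComm_add_left, add_sub_right_comm, add_sub_assoc, h1, h2]
  abel
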